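/- Let $N\ge 2$ and $\alpha\in\mathbb R$. Write $x=(x_1,\dots,x_N)\in\mathbb R^{2N}$ with $x_j=(x_{j1},x_{j2})\in\mathbb R^2$, put $r_{jk}=|x_j-x_k|$, and for $j=1,\dots,N$ let $$\mathbf F_j(x)=\alpha\Bigl(-\sum_{k\ne j}\frac{x_{j2}-x_{k2}}{r_{jk}^2},\ \sum_{k\ne j}\frac{x_{j1}-x_{k1}}{r_{jk}^2}\Bigr),\qquad D_{N,\alpha}=\min_{l=1,\dots,N-1}\Bigl(\frac{\min_{k\in\mathbb Z}|k-l\alpha|}{l}\Bigr)^2 .$$ Let $\Omega=\{x\in\mathbb R^{2N}: x_j\ne x_k \text{ for all } j\neq k\}$. Then for every $u:\mathbb R^{2N}\to\mathbb C$ in $H^1_{\rm loc}(\Omega)$ (that is, $u$ and its weak first-order derivatives on $\Omega$ are in $L^2_{\rm loc}(\Omega)$), $$\int_{\mathbb R^{2N}}\sum_{j=1}^N|(i\nabla_{x_j}+\mathbf F_j)u|^2\,dx\ \ge\ D_{N,\alpha}\int_{\mathbb R^{2N}}|u|^2\Bigl(\sum_{j=1}^N\sum_{k\ne j}\frac1{r_{kj}^2}\Bigr)dx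 ,$$ where $\nabla_{x_j}u$ is the weak gradient on $\Omega$ in the variable $x_j$, and both integrals take values in $[0,\infty]$, with $0\cdot\infty=0$. -/

import Mathlib

open MeasureTheory
open scoped ContDiff

noncomputable section

namespace ManyParticleHardy

/-- Configurations `x = (x_1, …, x_N)` of `N` particles in the plane, i.e. `ℝ^{2N}`;
its `volume` is Lebesgue measure. -/
abbrev Config (N : ℕ) : Type := Fin N → EuclideanSpace ℝ (Fin 2)

/-- The open set of collision-free configurations: `x_j ≠ x_k` whenever `j ≠ k`. -/
def collisionFree (N : ℕ) : Set (Config N) := {x | Function.Injective x}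

/-- The Aharonov-Bohm vector potential `F_j` felt by particle `j` when each of the other particles
carries a solenoid of flux `α`. -/
def potential {N : ℕ} (α : ℝ) (x : Config N) (j : Fin N) : EuclideanSpace ℝ (Fin 2) :=
  α • !₂[-∑ k ∈ Finset.univ.erase j, (x j 1 - x k 1) / dist (x j) (x k) ^ 2,
    ∑ k ∈ Finset.univ.erase j, (x j 0 - x k 0) / dist (x j) (x k) ^ 2]

/-- The coordinate direction of `x_{j,m}` in `ℝ^{2N}`. -/
def coordDir {N : ℕ} (j : Fin N) (m : Fin 2) : Config N :=
  Pi.single j (EuclideanSpace.single m (1 : ℝ))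

/-- `f ∈ L²_loc(Ω)`: square integrability on all compact subsets of `Ω`. -/
def IsLocallyL2On {N : ℕ} (f : Config N → ℂ) (Ω : Set (Config N)) : Prop :=
  ∀ K : Set (Config N), IsCompact K → K ⊆ Ω → MemLp f 2 (volume.restrict K)

/-- `g` is the weak partial derivative of `u` on `Ω` in the direction `v`, tested against
`C_c^∞(Ω)`. (The integrands vanish outside the support of `φ`.) -/
def IsWeakDerivOn {N : ℕ} (u g : Config N → ℂ) (v : Config N) (Ω : Set (Config N)) : Prop :=
  ∀ φ : Config N → ℝ, ContDiff ℝ ∞ φ → HasCompactSupport φ → tsupport φ ⊆ Ω →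
    ∫ x, u x * (fderiv ℝ φ x v : ℂ) = -∫ x, g x * (φ x : ℂ)

/-- `u ∈ H^1_loc(Ω)`, with weak gradient `g`, where `g j m = ∂u/∂x_{j,m}`. -/
structure IsH1LocOn {N : ℕ} (u : Config N → ℂ) (g : Fin N → Fin 2 → Config N → ℂ)
    (Ω : Set (Config N)) : Prop where
  locallyL2 : IsLocallyL2On u Ω
  locallyL2_grad : ∀ j m, IsLocallyL2On (g j m) Ω
  weakDeriv : ∀ j m, IsWeakDerivOn u (g j m) (coordDir j m) Ω

/-- The squared length `|(i∇_{x_j} + F_j) u|²` at `x`, where `g` is the gradient of `u`. -/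
def magneticDensity {N : ℕ} (α : ℝ) (u : Config N → ℂ) (g : Fin N → Fin 2 → Config N → ℂ)
    (j : Fin N) (x : Config N) : ℝ :=
  ∑ m : Fin 2, ‖Complex.I * g j m x + (potential α x j m : ℂ) * u x‖ ^ 2

/-- `∑_{k ≠ j} 1 / r_{kj}²`, the sum over all ordered pairs of distinct particles. -/
def pairSum {N : ℕ} (x : Config N) : ℝ :=
  ∑ j : Fin N, ∑ k ∈ Finset.univ.erase j, 1 / dist (x k) (x j) ^ 2

/-- `D_{N,α} = min_{1 ≤ l ≤ N-1} (min_{k ∈ ℤ} |k - lα| / l)²`. -/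
def hardyConst (N : ℕ) (hN : 2 ≤ N) (α : ℝ) : ℝ :=
  (Finset.Icc 1 (N - 1)).inf' (Finset.nonempty_Icc.mpr (Nat.le_sub_of_add_le hN))
    fun l => ((⨅ k : ℤ, |(k : ℝ) - (l : ℝ) * α|) / (l : ℝ)) ^ 2

end ManyParticleHardy

end

/-! Identify the plane with ℂ and fix all particles but `j`. With P(z) = ∏_{k≠j} (z - x_k) and S_j =
P'(x_j)/P(x_j) = ∑_{k≠j} 1/(x_j - x_k), the potential is F_j = α(Im S_j, Re S_j), which is α times
the gradient of arg P. Its field lines are level curves of |P|, and the vector field X = i/S_j moves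
x_j along them so that P(x_j) turns with unit angular speed.

Off a null set (`volume_compl_regularSet`), the circle |w| = |P(x_j)| meets no critical value of P.
Over such values `polyMap` is a proper local homeomorphism, hence a covering, and the rotation lifts
to a complete flow (`exists_rotFlow`). Its fibres have at most N - 1 points, so every orbit closes
after some l ≤ N - 1 turns (`exists_period`).

Since (Im S_j, Re S_j) = |S_j|² X is divergence free, the flow preserves |S_j|² dx. On an orbit of
period 2πl the operator i d/dt + α has eigenvalues α - m/l, whose squares are at least D_{N,α}.
Parseval on each orbit, integrated over all orbits, gives `IsFlowOn.hardy`. By Cauchy-Schwarz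
(`normSq_mul_le_magnetic`) the component along X is controlled by the full magnetic gradient, so D ∫
|u|²|S_j|² ≤ ∫ |(i∇_j + F_j)u|² (`hardy_particle`).

Now sum over `j`. Expanding |S_j|² gives the pair sum plus cross terms, which group into cyclic sums
over triangles. Each cyclic sum is 1/(2R²) for circumradius R, or 0 for collinear points, hence
nonnegative (`cyclic_sum_nonneg`, `sum_normSq_inv_le`).

No regularity of u along single orbits is needed: the orbitwise Fourier coefficients are computed
from the weak derivative by averaging test functions along the flow (`IsFlowOn.ae_fourier`). -/

noncomputable section
namespace ManyParticleHardy
open Set Complex Topology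

/-! ### Fourier series on a circle. -/

/-- The one-dimensional magnetic inequality on a circle of length `L`, in terms of Fourier
coefficients. -/
theorem integral_sq_le_of_fourierCoeffOn {L : ℝ} (hL : 0 < L) {f h : ℝ → ℂ} {α D : ℝ}
    (hf : MemLp f 2 (volume.restrict (Ioc 0 L))) (hh : MemLp h 2 (volume.restrict (Ioc 0 L)))
    (κ : ℤ → ℝ)
    (hfh : ∀ n, fourierCoeffOn hL h n = I * κ n * fourierCoeffOn hL f n)
    (hD : ∀ n, fourierCoeffOn hL f n = 0 ∨ D ≤ (α - κ n) ^ 2) :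
    D * ∫ s in (0 : ℝ)..L, ‖f s‖ ^ 2 ≤ ∫ s in (0 : ℝ)..L, ‖I * h s + α * f s‖ ^ 2 := by
  have hsum : MemLp (fun s => I * h s + α * f s) 2 (volume.restrict (Ioc 0 L)) :=
    (hh.const_mul I).add (hf.const_mul (α : ℂ))
  have hcoeff : ∀ n, fourierCoeffOn hL (fun s => I * h s + α * f s) n
      = ((α - κ n : ℝ) : ℂ) * fourierCoeffOn hL f n := by
    intro n
    have hint : ∀ {w : ℝ → ℂ} (c : ℂ), MemLp w 2 (volume.restrict (Ioc 0 L)) →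
        IntervalIntegrable (fun s => fourier (-n) (s : AddCircle (L - 0)) • (c * w s)) volume 0 L := by
      intro w c hw
      rw [intervalIntegrable_iff_integrableOn_Ioc_of_le hL.le]
      have h1 : Integrable (fun s => c * w s) (volume.restrict (Ioc 0 L)) :=
        ((hw.const_mul c).integrable (by norm_num))
      refine h1.bdd_mul (c := 1) ?_ ?_
      · exact ((map_continuous (fourier (-n))).comp
          (AddCircle.continuous_mk' _)).aestronglyMeasurable
      · exact Filter.Eventually.of_forall fun s => (Circle.norm_coe _).le
    have hadd : fourierCoeffOn hL (fun s => I * h s + α * f s) n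
        = fourierCoeffOn hL (fun s => I * h s) n + fourierCoeffOn hL (fun s => (α : ℂ) * f s) n := by
      simp only [fourierCoeffOn_eq_integral]
      rw [← smul_add, ← intervalIntegral.integral_add (hint I hh) (hint _ hf)]
      simp only [smul_add]
    rw [hadd, fourierCoeffOn.const_mul, fourierCoeffOn.const_mul, hfh]
    push_cast
    linear_combination (κ n * fourierCoeffOn hL f n : ℂ) * I_mul_I
  have h1 := hasSum_sq_fourierCoeffOn hL hf
  have h2 := hasSum_sq_fourierCoeffOn hL hsum
  have h3 := hasSum_le (fun n => ?_) (h1.mul_left D) h2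
  · simp only [smul_eq_mul, sub_zero] at h3
    have : 0 < L⁻¹ := inv_pos.2 hL
    rw [mul_left_comm] at h3
    exact le_of_mul_le_mul_left h3 this
  · rw [hcoeff, norm_mul, mul_pow, norm_real, Real.norm_eq_abs, sq_abs]
    rcases hD n with h0 | h0
    · simp [h0]
    · exact mul_le_mul_of_nonneg_right h0 (sq_nonneg _)

/-- A Fourier coefficient of a function with a further period `p` vanishes unless the character
has period `p`. -/
theorem fourierCoeffOn_eq_zero_of_periodic {L p : ℝ} (hL : 0 < L) {f : ℝ → ℂ}
    (hfL : Function.Periodic f L) (hfp : Function.Periodic f p) (n : ℤ)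
    (hn : exp (-(2 * Real.pi * I * n * p / L)) ≠ 1) : fourierCoeffOn hL f n = 0 := by
  set w : ℝ → ℂ := fun s => exp (-(2 * Real.pi * I * n * s / L)) * f s with hw
  have hL0 : (L : ℂ) ≠ 0 := by exact_mod_cast hL.ne'
  have hper : Function.Periodic w L := by
    intro s
    simp only [hw]
    rw [hfL s]
    congr 1
    rw [Complex.exp_eq_exp_iff_exists_int]
    exact ⟨-n, by push_cast; field_simp; ring⟩
  have hshift : ∀ s, w (s + p) = exp (-(2 * Real.pi * I * n * p / L)) * w s := by
    intro s
    simp only [hw]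
    rw [hfp s, ← mul_assoc, ← Complex.exp_add]
    congr 2
    push_cast
    ring
  -- Translation by `p` leaves the integral over a full period unchanged, yet multiplies it by a
  -- factor different from 1.
  have h1 : ∫ s in (0 : ℝ)..L, w (s + p) = ∫ s in (0 : ℝ)..L, w s := by
    rw [intervalIntegral.integral_comp_add_right]
    have := hper.intervalIntegral_add_eq p 0
    rw [zero_add] at this
    rw [zero_add, add_comm L p, this]
  simp only [hshift] at h1
  rw [intervalIntegral.integral_const_mul] at h1
  have h2 : ∫ s in (0 : ℝ)..L, w s = 0 := by
    by_contra h
    exact hn (mul_right_cancel₀ h (by rw [h1, one_mul]))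
  rw [fourierCoeffOn_eq_integral]
  have h3 : ∀ s : ℝ, fourier (-n) (s : AddCircle (L - 0)) • f s = w s := by
    intro s
    rw [fourier_coe_apply, smul_eq_mul, hw]
    congr 2
    push_cast
    rw [sub_zero]
    ring
  simp only [h3, h2, smul_zero]

/-! ### Test functions, and measures determined by them; flows acting on test functions. -/

/-- The real-valued test functions `C_c^∞(E)`. -/
structure IsTestOn {V : Type*} [NormedAddCommGroup V] [NormedSpace ℝ V]
    (φ : V → ℝ) (E : Set V) : Prop where
  contDiff : ContDiff ℝ ∞ φ
  hasCompactSupport : HasCompactSupport φ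
  tsupport_subset : tsupport φ ⊆ E

/-- A complete smooth flow `Φ` on the set `E`, generated by the vector field `X` and extended by
the identity outside `E`. -/
structure IsFlowOn {V : Type*} [NormedAddCommGroup V] [NormedSpace ℝ V]
    (Φ : ℝ → V → V) (X : V → V) (E : Set V) : Prop where
  mapsTo : ∀ t x, x ∈ E → Φ t x ∈ E
  eq_self : ∀ t x, x ∉ E → Φ t x = x
  zero : ∀ x, Φ 0 x = x
  add : ∀ s t x, Φ (s + t) x = Φ s (Φ t x)
  continuousOn : ContinuousOn (fun q : ℝ × V => Φ q.1 q.2) (univ ×ˢ E)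
  contDiffOn : ∀ t, ContDiffOn ℝ ∞ (Φ t) E
  hasDerivAt : ∀ t x, x ∈ E → HasDerivAt (fun s => Φ s x) (X (Φ t x)) t

theorem contDiff_of_contDiffAt_tsupport {V W : Type*} [NormedAddCommGroup V] [NormedSpace ℝ V]
    [NormedAddCommGroup W] [NormedSpace ℝ W] {n : WithTop ℕ∞} {f : V → W}
    (h : ∀ x ∈ tsupport f, ContDiffAt ℝ n f x) : ContDiff ℝ n f := by
  refine contDiff_iff_contDiffAt.2 fun x => ?_
  by_cases hx : x ∈ tsupport f
  · exact h x hx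
  · have : f =ᶠ[𝓝 x] fun _ => 0 := by
      filter_upwards [(isClosed_tsupport f).isOpen_compl.mem_nhds hx] with y hy
      exact image_eq_zero_of_notMem_tsupport hy
    exact contDiffAt_const.congr_of_eventuallyEq this

/-- Measures that agree on test functions supported in an open set, and vanish outside, agree. -/
theorem measure_eq_of_integral_test_eq {V : Type*} [NormedAddCommGroup V] [NormedSpace ℝ V]
    [FiniteDimensional ℝ V] [MeasurableSpace V] [BorelSpace V] {E : Set V} (hE : IsOpen E)
    {μ ν : Measure V} (hμE : μ Eᶜ = 0) (hνE : ν Eᶜ = 0)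
    (hμ : ∀ K, IsCompact K → K ⊆ E → μ K < ⊤) (hν : ∀ K, IsCompact K → K ⊆ E → ν K < ⊤)
    (h : ∀ φ, IsTestOn φ E → ∫ x, φ x ∂μ = ∫ x, φ x ∂ν) : μ = ν := by
  -- One inequality on open sets suffices, by symmetry: exhaust `U` by compact sets and put a smooth
  -- bump between each of them and `U`.
  have key : ∀ {μ ν : Measure V}, (∀ K, IsCompact K → K ⊆ E → μ K < ⊤) →
      (∀ K, IsCompact K → K ⊆ E → ν K < ⊤) →
      (∀ φ, IsTestOn φ E → ∫ x, φ x ∂μ = ∫ x, φ x ∂ν) →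
      ∀ U, IsOpen U → U ⊆ E → μ U ≤ ν U := by
    intro μ ν hμ hν h U hU hUE
    obtain ⟨F, hFc, hFU, hFm⟩ : ∃ F : ℕ → Set V, (∀ n, IsCompact (F n)) ∧ (⋃ n, F n) = U ∧
        Monotone F := by
      obtain ⟨F, h1, h2, h3, h4⟩ := hU.exists_iUnion_isClosed
      refine ⟨fun n => F n ∩ Metric.closedBall 0 n, fun n => ?_, ?_, ?_⟩
      · exact (isCompact_closedBall _ _).inter_left (h1 n)
      · refine Subset.antisymm (iUnion_subset fun n => inter_subset_left.trans (h2 n)) ?_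
        intro x hx
        rw [← h3] at hx
        obtain ⟨n, hn⟩ := mem_iUnion.1 hx
        obtain ⟨m, hm⟩ := exists_nat_ge ‖x‖
        refine mem_iUnion.2 ⟨max n m, h4 (le_max_left _ _) hn, ?_⟩
        rw [mem_closedBall_zero_iff]
        exact hm.trans (by exact_mod_cast le_max_right n m)
      · intro n m hnm
        exact inter_subset_inter (h4 hnm) (Metric.closedBall_subset_closedBall (by exact_mod_cast hnm))
    rw [← hFU, hFm.measure_iUnion, hFU]
    refine iSup_le fun n => ?_
    have hFn : F n ⊆ U := hFU ▸ subset_iUnion F n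
    obtain ⟨K', hK', hK1, hK2⟩ := exists_compact_between (hFc n) hU hFn
    obtain ⟨φ, hφ1, hφ2, hφ3⟩ : ∃ φ : V → ℝ, IsTestOn φ U ∧ (∀ x ∈ F n, φ x = 1) ∧
        ∀ x, φ x ∈ Icc (0 : ℝ) 1 := by
      obtain ⟨φ, h1, h2, h3, h4⟩ := exists_contMDiff_support_eq_eq_one_iff
        (modelWithCornersSelf ℝ V) (n := (⊤ : ℕ∞)) (isOpen_interior (s := K')) (hFc n).isClosed hK1
      have hsub : tsupport φ ⊆ K' := by
        rw [tsupport, h3]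
        exact closure_minimal interior_subset hK'.isClosed
      refine ⟨φ, ⟨h1.contDiff, hK'.of_isClosed_subset (isClosed_tsupport _) hsub,
        hsub.trans hK2⟩, fun x hx => (h4 x).1 hx, fun x => h2 ⟨x, rfl⟩⟩
    have hφE : IsTestOn φ E := ⟨hφ1.contDiff, hφ1.hasCompactSupport, hφ1.tsupport_subset.trans hUE⟩
    have hint : ∀ {m : Measure V}, (∀ K, IsCompact K → K ⊆ E → m K < ⊤) → Integrable φ m := by
      intro m hm
      have h1 : IntegrableOn φ (tsupport φ) m :=
        hφE.contDiff.continuous.continuousOn.integrableOn_of_subset_isCompact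
          hφE.hasCompactSupport (isClosed_tsupport φ).measurableSet subset_rfl
          (hm _ hφE.hasCompactSupport hφE.tsupport_subset).ne
      rwa [integrableOn_iff_integrable_of_support_subset (subset_tsupport φ)] at h1
    have hlin : ∀ {m : Measure V}, (∀ K, IsCompact K → K ⊆ E → m K < ⊤) →
        ∫⁻ x, ENNReal.ofReal (φ x) ∂m = ENNReal.ofReal (∫ x, φ x ∂m) := fun hm =>
      (ofReal_integral_eq_lintegral_ofReal (hint hm)
        (Filter.Eventually.of_forall fun x => (hφ3 x).1)).symm
    calc μ (F n) = ∫⁻ x, (F n).indicator 1 x ∂μ := by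
          rw [lintegral_indicator_one (hFc n).isClosed.measurableSet]
      _ ≤ ∫⁻ x, ENNReal.ofReal (φ x) ∂μ := by
          refine lintegral_mono fun x => ?_
          by_cases hx : x ∈ F n
          · simp [hx, hφ2 x hx]
          · simp [hx]
      _ = ∫⁻ x, ENNReal.ofReal (φ x) ∂ν := by rw [hlin hμ, hlin hν, h φ hφE]
      _ ≤ ∫⁻ x, U.indicator 1 x ∂ν := by
          refine lintegral_mono fun x => ?_
          by_cases hx : x ∈ U
          · simpa [hx] using (hφ3 x).2
          · have : φ x = 0 := image_eq_zero_of_notMem_tsupport fun h => hx (hφ1.tsupport_subset h)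
            simp [this]
      _ = ν U := lintegral_indicator_one hU.measurableSet
  have hopen : ∀ U, IsOpen U → U ⊆ E → μ U = ν U := fun U hU hUE =>
    le_antisymm (key hμ hν h U hU hUE) (key hν hμ (fun φ hφ => (h φ hφ).symm) U hU hUE)
  have hball : ∀ x ∈ E, ∃ r > 0, Metric.closedBall x r ⊆ E := fun x hx =>
    Metric.nhds_basis_closedBall.mem_iff.1 (hE.mem_nhds hx)
  choose! r hr0 hrE using hball
  obtain ⟨t, htE, htc, hcov⟩ := TopologicalSpace.countable_cover_nhdsWithin
    (f := fun x => Metric.ball x (r x)) (s := E)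
    fun x hx => mem_nhdsWithin_of_mem_nhds (Metric.ball_mem_nhds x (hr0 x hx))
  -- On each ball the measures are finite, so agreement on the π-system of open sets determines
  -- them; countably many balls cover `E`.
  have hres : μ.restrict (⋃ x ∈ t, Metric.ball x (r x)) =
      ν.restrict (⋃ x ∈ t, Metric.ball x (r x)) := by
    rw [Measure.restrict_biUnion_congr htc]
    intro x hx
    have hsub := hrE x (htE hx)
    have hbE := Metric.ball_subset_closedBall.trans hsub
    have : IsFiniteMeasure (μ.restrict (Metric.ball x (r x))) :=
      ⟨by rw [Measure.restrict_apply_univ]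
          exact (measure_mono Metric.ball_subset_closedBall).trans_lt
            (hμ _ (isCompact_closedBall _ _) hsub)⟩
    refine ext_of_generate_finite {U : Set V | IsOpen U} (BorelSpace.measurable_eq)
      isPiSystem_isOpen (fun U hU => ?_) ?_
    · rw [Measure.restrict_apply hU.measurableSet, Measure.restrict_apply hU.measurableSet]
      exact hopen _ (hU.inter Metric.isOpen_ball) (inter_subset_right.trans hbE)
    · rw [Measure.restrict_apply_univ, Measure.restrict_apply_univ]
      exact hopen _ Metric.isOpen_ball hbE
  have hfull : ∀ {m : Measure V}, m Eᶜ = 0 →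
      m.restrict (⋃ x ∈ t, Metric.ball x (r x)) = m := fun {m} hm =>
    Measure.restrict_eq_self_of_ae_mem (by
      rw [ae_iff]
      exact measure_mono_null (fun x hx hxE => hx (hcov hxE)) hm)
  rw [← hfull hμE, hres, hfull hνE]

namespace IsFlowOn

variable {V : Type*} [NormedAddCommGroup V] [NormedSpace ℝ V]
  {Φ : ℝ → V → V} {X : V → V} {E : Set V}

theorem mem_iff (hΦ : IsFlowOn Φ X E) (t : ℝ) (x : V) : Φ t x ∈ E ↔ x ∈ E := by
  refine ⟨fun h => ?_, hΦ.mapsTo t x⟩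
  by_contra hx
  rw [hΦ.eq_self t x hx] at h
  exact hx h

theorem neg_apply (hΦ : IsFlowOn Φ X E) (t : ℝ) (x : V) : Φ (-t) (Φ t x) = x := by
  rw [← hΦ.add, neg_add_cancel, hΦ.zero]

theorem apply_neg (hΦ : IsFlowOn Φ X E) (t : ℝ) (x : V) : Φ t (Φ (-t) x) = x := by
  rw [← hΦ.add, add_neg_cancel, hΦ.zero]

theorem measurable [MeasurableSpace V] [BorelSpace V] [SecondCountableTopology V]
    (hΦ : IsFlowOn Φ X E) (hE : IsOpen E) : Measurable fun q : ℝ × V => Φ q.1 q.2 := by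
  classical
  have h := ContinuousOn.measurable_piecewise (s := (univ : Set ℝ) ×ˢ E) hΦ.continuousOn
    (g := Prod.snd) continuous_snd.continuousOn (isOpen_univ.prod hE).measurableSet
  convert h using 1
  ext q
  by_cases hq : q.2 ∈ E
  · simp [piecewise, hq]
  · simp [piecewise, hq, hΦ.eq_self]

theorem measurable_apply [MeasurableSpace V] [BorelSpace V] [SecondCountableTopology V]
    (hΦ : IsFlowOn Φ X E) (hE : IsOpen E) (t : ℝ) : Measurable (Φ t) :=
  (hΦ.measurable hE).comp (measurable_const.prodMk measurable_id)

theorem isCompact_image (hΦ : IsFlowOn Φ X E) {I : Set ℝ} {K : Set V} (hI : IsCompact I)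
    (hK : IsCompact K) (hKE : K ⊆ E) : IsCompact ((fun q : ℝ × V => Φ q.1 q.2) '' I ×ˢ K) :=
  (hI.prod hK).image_of_continuousOn (hΦ.continuousOn.mono (prod_mono (subset_univ _) hKE))

theorem image_subset (hΦ : IsFlowOn Φ X E) {I : Set ℝ} {K : Set V} (hKE : K ⊆ E) :
    (fun q : ℝ × V => Φ q.1 q.2) '' I ×ˢ K ⊆ E := by
  rintro _ ⟨⟨s, y⟩, ⟨-, hy⟩, rfl⟩
  exact hΦ.mapsTo _ _ (hKE hy)

theorem tsupport_comp_subset (hΦ : IsFlowOn Φ X E) {φ : V → ℝ} (hφ : IsTestOn φ E) (s : ℝ) :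
    tsupport (fun x => φ (Φ s x)) ⊆ (fun q : ℝ × V => Φ q.1 q.2) '' {-s} ×ˢ tsupport φ := by
  refine closure_minimal (fun x hx => ?_)
    (hΦ.isCompact_image isCompact_singleton hφ.hasCompactSupport hφ.tsupport_subset).isClosed
  exact ⟨(-s, Φ s x), ⟨rfl, subset_tsupport _ hx⟩, hΦ.neg_apply s x⟩

theorem isTestOn_comp (hΦ : IsFlowOn Φ X E) (hE : IsOpen E) {φ : V → ℝ} (hφ : IsTestOn φ E)
    (s : ℝ) : IsTestOn (fun x => φ (Φ s x)) E where
  contDiff := by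
    refine contDiff_of_contDiffAt_tsupport fun x hx => ?_
    have hxE : x ∈ E := hΦ.image_subset hφ.tsupport_subset (hΦ.tsupport_comp_subset hφ s hx)
    exact hφ.contDiff.contDiffAt.comp x ((hΦ.contDiffOn s).contDiffAt (hE.mem_nhds hxE))
  hasCompactSupport :=
    (hΦ.isCompact_image isCompact_singleton hφ.hasCompactSupport
      hφ.tsupport_subset).of_isClosed_subset (isClosed_tsupport _) (hΦ.tsupport_comp_subset hφ s)
  tsupport_subset := (hΦ.tsupport_comp_subset hφ s).trans (hΦ.image_subset hφ.tsupport_subset)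

theorem hasDerivAt_test (hΦ : IsFlowOn Φ X E) {φ : V → ℝ} (hφ : IsTestOn φ E) (x : V) (s : ℝ) :
    HasDerivAt (fun s => φ (Φ s x)) (fderiv ℝ φ (Φ s x) (X (Φ s x))) s := by
  by_cases hx : x ∈ E
  · exact ((hφ.contDiff.differentiable (by simp)) _).hasFDerivAt.comp_hasDerivAt s
      (hΦ.hasDerivAt s x hx)
  · have h0 : fderiv ℝ φ x = 0 := image_eq_zero_of_notMem_tsupport fun h =>
      hx (hφ.tsupport_subset (tsupport_fderiv_subset ℝ h))
    simp only [hΦ.eq_self _ x hx, h0]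
    exact hasDerivAt_const _ _

/-- The derivation along `X` commutes with its own flow: differentiate φ(Φ_{s+t} x) at t = 0, once
as φ ∘ Φ_s evaluated along the orbit, once as a time shift. -/
theorem fderiv_comp (hΦ : IsFlowOn Φ X E) (hE : IsOpen E) {φ : V → ℝ} (hφ : IsTestOn φ E) (s : ℝ)
    (x : V) :
    fderiv ℝ (fun y => φ (Φ s y)) x (X x) = fderiv ℝ φ (Φ s x) (X (Φ s x)) := by
  have h1 := hΦ.hasDerivAt_test (hΦ.isTestOn_comp hE hφ s) x 0
  have h2 := hΦ.hasDerivAt_test hφ x (s + 0)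
  simp only [← hΦ.add] at h1
  rw [hΦ.zero] at h1
  have h3 := h2.comp_const_add s 0
  simp only [add_zero] at h3
  exact h1.unique h3

/-- `φ ↦ Xφ` maps test functions to continuous functions with compact support in `E`. -/
theorem _root_.ManyParticleHardy.IsTestOn.continuous_fderiv_apply {φ : V → ℝ} (hφ : IsTestOn φ E)
    (hX : ContinuousOn X E) (hE : IsOpen E) : Continuous fun x => fderiv ℝ φ x (X x) := by
  rw [continuous_iff_continuousAt]
  intro x
  by_cases hx : x ∈ tsupport φ
  · exact (hφ.contDiff.continuous_fderiv (by simp)).continuousAt.clm_apply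
      (hX.continuousAt (hE.mem_nhds (hφ.tsupport_subset hx)))
  · have : (fun x => fderiv ℝ φ x (X x)) =ᶠ[𝓝 x] fun _ => 0 := by
      filter_upwards [(isClosed_tsupport φ).isOpen_compl.mem_nhds hx] with y hy
      rw [image_eq_zero_of_notMem_tsupport fun h => hy (tsupport_fderiv_subset ℝ h)]
      rfl
    exact this.continuousAt

theorem _root_.ManyParticleHardy.IsTestOn.tsupport_fderiv_apply {φ : V → ℝ} :
    tsupport (fun x => fderiv ℝ φ x (X x)) ⊆ tsupport φ := by
  refine closure_minimal (fun x hx => ?_) (isClosed_tsupport φ)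
  refine tsupport_fderiv_subset ℝ (subset_tsupport _ fun h => hx ?_)
  simp [h]

end IsFlowOn

/-- A property that holds almost everywhere on compact subsets of `E` holds almost everywhere. -/
theorem ae_of_forall_isCompact {V : Type*} [NormedAddCommGroup V] [NormedSpace ℝ V]
    [FiniteDimensional ℝ V] [MeasurableSpace V] [BorelSpace V] {μ : Measure V} {E : Set V}
    (hE : IsOpen E) (hμE : μ Eᶜ = 0)
    {p : V → Prop}
    (hp : ∀ K, IsCompact K → K ⊆ E → ∀ᵐ x ∂μ.restrict K, p x) : ∀ᵐ x ∂μ, p x := by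
  have h1 : μ ({x | ¬ p x} ∩ E) = 0 := by
    refine measure_null_of_locally_null _ fun x hx => ?_
    obtain ⟨r, hr, hrE⟩ := Metric.nhds_basis_closedBall.mem_iff.1 (hE.mem_nhds hx.2)
    have h2 := hp _ (isCompact_closedBall x r) hrE
    rw [ae_restrict_iff' Metric.isClosed_closedBall.measurableSet, ae_iff] at h2
    refine ⟨({x | ¬ p x} ∩ E) ∩ Metric.closedBall x r,
      inter_mem_nhdsWithin _ (Metric.closedBall_mem_nhds x hr), ?_⟩
    refine measure_mono_null (fun y hy => ?_) h2
    simp only [mem_ofPred_eq, Classical.not_imp]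
    exact ⟨hy.2, hy.1.1⟩
  rw [ae_iff]
  refine measure_mono_null (fun x hx => ?_) (measure_union_null h1 hμE)
  by_cases hxE : x ∈ E
  · exact Or.inl ⟨hx, hxE⟩
  · exact Or.inr hxE

/-! ### Integration along flows, and the Hardy inequality for a periodic measure-preserving flow. -/

namespace IsFlowOn

variable {V : Type*} [NormedAddCommGroup V] [NormedSpace ℝ V]
  {Φ : ℝ → V → V} {X : V → V} {E : Set V}
  [FiniteDimensional ℝ V] [MeasurableSpace V] [BorelSpace V]
  {μ : Measure V} [SFinite μ] {u h : V → ℂ}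

/-- For times in [0, T] the functions χ ∘ Φ_s are all supported in one compact subset of `E`, the
backward sweep of the support of χ, so local integrability of `u` is enough for Fubini. -/
theorem integrable_prod_comp (hΦ : IsFlowOn Φ X E) (hE : IsOpen E)
    (hu : ∀ K, IsCompact K → K ⊆ E → IntegrableOn u K μ) {c : ℝ → ℂ} (hc : Continuous c)
    (hc1 : ∀ s, ‖c s‖ ≤ 1) {χ : V → ℝ} (hχ : Continuous χ) (hχc : HasCompactSupport χ)
    (hχE : tsupport χ ⊆ E) (T : ℝ) :
    Integrable (fun q : ℝ × V => u q.2 * (c q.1 * χ (Φ q.1 q.2)))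
      ((volume.restrict (Ioc 0 T)).prod μ) := by
  set K : Set V := (fun q : ℝ × V => Φ q.1 q.2) '' (Neg.neg '' Icc 0 T) ×ˢ tsupport χ with hKdef
  have hK : IsCompact K :=
    hΦ.isCompact_image (isCompact_Icc.image continuous_neg) hχc hχE
  have hKE : K ⊆ E := hΦ.image_subset hχE
  have hKm : MeasurableSet K := hK.isClosed.measurableSet
  have h1 : Integrable (K.indicator u) μ := (integrable_indicator_iff hKm).2 (hu K hK hKE)
  have h2 := h1.comp_snd (volume.restrict (Ioc 0 T))
  obtain ⟨C, hC⟩ := hχc.exists_bound_of_continuous hχ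
  have hmeas : AEStronglyMeasurable (fun q : ℝ × V => c q.1 * (χ (Φ q.1 q.2) : ℂ))
      ((volume.restrict (Ioc 0 T)).prod μ) := by
    refine (Measurable.mul (hc.measurable.comp measurable_fst) ?_).aestronglyMeasurable
    exact measurable_ofReal.comp (hχ.measurable.comp (hΦ.measurable hE))
  have h3 := h2.mul_bdd (c := C) hmeas (Filter.Eventually.of_forall fun q => by
    rw [norm_mul, norm_real]
    calc ‖c q.1‖ * ‖χ (Φ q.1 q.2)‖ ≤ 1 * ‖χ (Φ q.1 q.2)‖ :=
          mul_le_mul_of_nonneg_right (hc1 _) (norm_nonneg _)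
      _ ≤ C := by rw [one_mul]; exact hC _)
  refine h3.congr ?_
  have hae : ∀ᵐ q ∂((volume.restrict (Ioc 0 T)).prod μ), q.1 ∈ Ioc 0 T :=
    Measure.quasiMeasurePreserving_fst.ae (ae_restrict_mem measurableSet_Ioc)
  filter_upwards [hae] with q hq
  by_cases hqK : q.2 ∈ K
  · simp [hqK]
  · have : χ (Φ q.1 q.2) = 0 := image_eq_zero_of_notMem_tsupport fun hmem =>
      hqK ⟨(-q.1, Φ q.1 q.2), ⟨⟨q.1, Ioc_subset_Icc_self hq, rfl⟩, hmem⟩, hΦ.neg_apply _ _⟩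
    simp [hqK, this]

theorem integral_comp_swap (hΦ : IsFlowOn Φ X E) (hE : IsOpen E)
    (hu : ∀ K, IsCompact K → K ⊆ E → IntegrableOn u K μ) {c : ℝ → ℂ} (hc : Continuous c)
    (hc1 : ∀ s, ‖c s‖ ≤ 1) {χ : V → ℝ} (hχ : Continuous χ) (hχc : HasCompactSupport χ)
    (hχE : tsupport χ ⊆ E) {T : ℝ} (hT : 0 ≤ T) :
    ∫ s in (0 : ℝ)..T, c s * ∫ x, u x * χ (Φ s x) ∂μ =
      ∫ x, u x * (∫ s in (0 : ℝ)..T, c s * χ (Φ s x)) ∂μ := by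
  have h := intervalIntegral_integral_swap (a := 0) (b := T) (μ := μ)
    (f := fun s x => u x * (c s * χ (Φ s x)))
    (by rw [uIoc_of_le hT]; exact hΦ.integrable_prod_comp hE hu hc hc1 hχ hχc hχE T)
  simp only [intervalIntegral.integral_const_mul] at h
  rw [← h]
  refine intervalIntegral.integral_congr fun s _ => ?_
  rw [← integral_const_mul]
  congr 1 with x
  ring

/-- Integration by parts along the flow, for a function `u` with weak derivative `h` in the
direction of the flow. -/
theorem integral_weak (hΦ : IsFlowOn Φ X E) (hE : IsOpen E) (hX : ContinuousOn X E)
    (hμE : μ Eᶜ = 0)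
    (hu : ∀ K, IsCompact K → K ⊆ E → IntegrableOn u K μ)
    (huh : ∀ φ, IsTestOn φ E →
      ∫ x, u x * (fderiv ℝ φ x (X x) : ℂ) ∂μ = -∫ x, h x * (φ x : ℂ) ∂μ)
    {φ : V → ℝ} (hφ : IsTestOn φ E) (κ : ℝ) {T : ℝ} (hT : 0 ≤ T) :
    ∫ s in (0 : ℝ)..T, exp (I * κ * s) * ∫ x, h x * φ (Φ s x) ∂μ =
      -∫ x, u x * (exp (I * κ * T) * φ (Φ T x) - φ x -
        I * κ * ∫ s in (0 : ℝ)..T, exp (I * κ * s) * φ (Φ s x)) ∂μ := by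
  have hc : Continuous fun s : ℝ => exp (I * κ * s) := by fun_prop
  have hc1 : ∀ s : ℝ, ‖exp (I * κ * s)‖ ≤ 1 := fun s => by
    rw [mul_assoc, mul_comm, ← ofReal_mul, norm_exp_ofReal_mul_I]
  -- φ ∘ Φ_s is again a test function, and its derivative along `X` is that of φ composed with Φ_s.
  have h1 : ∀ s, ∫ x, h x * (φ (Φ s x) : ℂ) ∂μ =
      -∫ x, u x * (fderiv ℝ φ (Φ s x) (X (Φ s x)) : ℂ) ∂μ := by
    intro s
    rw [eq_neg_iff_add_eq_zero, ← neg_eq_iff_add_eq_zero, ← huh _ (hΦ.isTestOn_comp hE hφ s)]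
    simp only [hΦ.fderiv_comp hE hφ]
  simp only [h1, mul_neg, intervalIntegral.integral_neg]
  have hXc := hφ.continuous_fderiv_apply hX hE
  have hsub : tsupport (fun x => fderiv ℝ φ x (X x)) ⊆ tsupport φ := IsTestOn.tsupport_fderiv_apply
  have h2 := hΦ.integral_comp_swap (μ := μ) hE hu hc hc1 hXc
    (hφ.hasCompactSupport.of_isClosed_subset (isClosed_tsupport _) hsub)
    (hsub.trans hφ.tsupport_subset) hT
  rw [h2]
  congr 1
  refine integral_congr_ae ?_
  have hae : ∀ᵐ x ∂μ, x ∈ E := by rw [ae_iff]; exact hμE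
  filter_upwards [hae] with x hx
  congr 1
  -- What remains is the fundamental theorem of calculus for e^{iκs} φ(Φ_s x) on each orbit.
  have hd : ∀ s : ℝ, HasDerivAt (fun s : ℝ => exp (I * κ * s) * φ (Φ s x))
      (exp (I * κ * s) * (I * κ) * φ (Φ s x) +
        exp (I * κ * s) * (fderiv ℝ φ (Φ s x) (X (Φ s x)) : ℂ)) s := by
    intro s
    refine HasDerivAt.mul ?_ (hΦ.hasDerivAt_test hφ x s).ofReal_comp
    have : HasDerivAt (fun s : ℝ => I * κ * (s : ℂ)) (I * κ) s := by
      simpa using (ofRealCLM.hasDerivAt (x := s)).const_mul (I * κ)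
    exact this.cexp
  have hcont : Continuous fun s => Φ s x := by
    have := hΦ.continuousOn.comp_continuous (f := fun s : ℝ => (s, x)) (by fun_prop)
      (fun s => ⟨mem_univ _, hx⟩)
    exact this
  have hi1 : Continuous fun s : ℝ => exp (I * κ * s) * (I * κ) * φ (Φ s x) := by
    have := hφ.contDiff.continuous.comp hcont
    exact (hc.mul continuous_const).mul (continuous_ofReal.comp this)
  have hi2 : Continuous fun s : ℝ =>
      exp (I * κ * s) * (fderiv ℝ φ (Φ s x) (X (Φ s x)) : ℂ) := by
    have := hXc.comp hcont
    exact hc.mul (continuous_ofReal.comp this)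
  have h3 := intervalIntegral.integral_eq_sub_of_hasDerivAt (a := 0) (b := T) (fun s _ => hd s)
    ((hi1.add hi2).intervalIntegrable _ _)
  rw [intervalIntegral.integral_add (hi1.intervalIntegrable _ _) (hi2.intervalIntegrable _ _)] at h3
  rw [← intervalIntegral.integral_const_mul, eq_sub_iff_add_eq']
  simp only [ofReal_zero, mul_zero, exp_zero, one_mul, hΦ.zero] at h3
  rw [← h3]
  congr 1
  refine intervalIntegral.integral_congr fun s _ => ?_
  ring

/-- A flow generated by a divergence-free field preserves the measure. -/
theorem measurePreserving (hΦ : IsFlowOn Φ X E) (hE : IsOpen E) (hX : ContinuousOn X E)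
    (hμE : μ Eᶜ = 0) (hμ : ∀ K, IsCompact K → K ⊆ E → μ K < ⊤)
    (hdiv : ∀ φ, IsTestOn φ E → ∫ x, fderiv ℝ φ x (X x) ∂μ = 0) (t : ℝ) :
    MeasurePreserving (Φ t) μ μ := by
  have hpos : ∀ t, 0 ≤ t → ∀ φ, IsTestOn φ E → ∫ x, φ (Φ t x) ∂μ = ∫ x, φ x ∂μ := by
    intro t ht φ hφ
    -- With u = 1, h = 0 and κ = 0 only the boundary terms φ ∘ Φ_t - φ survive.
    have h := hΦ.integral_weak (μ := μ) (u := fun _ => 1) (h := fun _ => 0) hE hX hμE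
      (fun K hK hKE => integrableOn_const (hμ K hK hKE).ne)
      (fun φ hφ => by simpa [integral_complex_ofReal] using hdiv φ hφ) hφ 0 ht
    have hint : ∀ φ, IsTestOn φ E → Integrable φ μ := by
      intro φ hφ
      have h1 : IntegrableOn φ (tsupport φ) μ :=
        hφ.contDiff.continuous.continuousOn.integrableOn_of_subset_isCompact
          hφ.hasCompactSupport (isClosed_tsupport φ).measurableSet subset_rfl
          (hμ _ hφ.hasCompactSupport hφ.tsupport_subset).ne
      rwa [integrableOn_iff_integrable_of_support_subset (subset_tsupport φ)] at h1
    simp only [zero_mul, integral_zero, mul_zero, intervalIntegral.integral_zero, ofReal_zero,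
      exp_zero, one_mul, sub_zero, zero_eq_neg, ← ofReal_sub] at h
    rw [integral_complex_ofReal, ofReal_eq_zero, integral_sub (hint _ (hΦ.isTestOn_comp hE hφ t))
      (hint _ hφ), sub_eq_zero] at h
    exact h
  have hall : ∀ φ, IsTestOn φ E → ∫ x, φ (Φ t x) ∂μ = ∫ x, φ x ∂μ := by
    intro φ hφ
    rcases le_total 0 t with ht | ht
    · exact hpos t ht φ hφ
    -- A negative time reduces to a positive one, applied to the test function φ ∘ Φ_t.
    · have := hpos (-t) (neg_nonneg.2 ht) _ (hΦ.isTestOn_comp hE hφ t)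
      simp only [hΦ.apply_neg] at this
      exact this.symm
  have hm := hΦ.measurable_apply hE t
  refine ⟨hm, measure_eq_of_integral_test_eq hE ?_ hμE ?_ hμ ?_⟩
  · rw [Measure.map_apply hm hE.isClosed_compl.measurableSet]
    refine measure_mono_null (fun x hx hxE => hx ((hΦ.mem_iff t x).2 hxE)) hμE
  · intro K hK hKE
    rw [Measure.map_apply hm hK.isClosed.measurableSet]
    refine (measure_mono fun x hx => ?_).trans_lt
      (hμ _ (hΦ.isCompact_image (isCompact_singleton (x := -t)) hK hKE) (hΦ.image_subset hKE))
    exact ⟨(-t, Φ t x), ⟨rfl, hx⟩, hΦ.neg_apply t x⟩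
  · intro φ hφ
    rw [integral_map hm.aemeasurable hφ.contDiff.continuous.aestronglyMeasurable, hall φ hφ]

/-- Averages along the flow over bounded times are bounded by averages over a larger set. -/
theorem lintegral_lintegral_le (hΦ : IsFlowOn Φ X E) (hE : IsOpen E)
    (hmp : ∀ t, MeasurePreserving (Φ t) μ μ) {F : V → ENNReal} (hF : Measurable F)
    {K : Set V} (hK : IsCompact K) (hKE : K ⊆ E) (T : ℝ) :
    ∫⁻ x in K, (∫⁻ s in Ioc 0 T, F (Φ (-s) x)) ∂μ ≤
      ENNReal.ofReal T *
        ∫⁻ x in (fun q : ℝ × V => Φ q.1 q.2) '' (Neg.neg '' Icc 0 T) ×ˢ K, F x ∂μ := by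
  set K' := (fun q : ℝ × V => Φ q.1 q.2) '' (Neg.neg '' Icc 0 T) ×ˢ K with hK'
  have hK'c : IsCompact K' := hΦ.isCompact_image (isCompact_Icc.image continuous_neg) hK hKE
  have hmeas : Measurable fun q : V × ℝ => F (Φ (-q.2) q.1) :=
    hF.comp ((hΦ.measurable hE).comp (measurable_snd.neg.prodMk measurable_fst))
  rw [lintegral_lintegral_swap hmeas.aemeasurable]
  calc ∫⁻ s in Ioc 0 T, ∫⁻ x in K, F (Φ (-s) x) ∂μ
      ≤ ∫⁻ s in Ioc 0 T, ∫⁻ x in K', F x ∂μ := by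
        refine setLIntegral_mono' measurableSet_Ioc fun s hs => ?_
        have hm' := hK'c.isClosed.measurableSet
        rw [← (hmp (-s)).setLIntegral_comp_preimage hm' hF]
        refine lintegral_mono_set fun x hx => ?_
        exact ⟨(-s, x), ⟨⟨s, Ioc_subset_Icc_self hs, rfl⟩, hx⟩, rfl⟩
    _ = ENNReal.ofReal T * ∫⁻ x in K', F x ∂μ := by
        rw [setLIntegral_const, Real.volume_Ioc, sub_zero, mul_comm]

/-- The square integral over an orbit segment, integrated over a compact set of starting points, is
at most T times the square integral over the swept compact set; being finite, it is finite at almost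
every point. -/
theorem ae_memLp_orbit (hΦ : IsFlowOn Φ X E) (hE : IsOpen E) (hμE : μ Eᶜ = 0)
    (hmp : ∀ t, MeasurePreserving (Φ t) μ μ) (hum : Measurable u)
    (hu : ∀ K, IsCompact K → K ⊆ E → MemLp u 2 (μ.restrict K)) (T : ℝ) :
    ∀ᵐ x ∂μ, MemLp (fun s => u (Φ (-s) x)) 2 (volume.restrict (Ioc 0 T)) := by
  refine ae_of_forall_isCompact hE hμE fun K hK hKE => ?_
  have hF : Measurable fun x => ‖u x‖ₑ ^ (2 : ℝ) := hum.enorm.pow_const _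
  have h1 := hΦ.lintegral_lintegral_le hE hmp hF hK hKE T
  have hK' := hu _ (hΦ.isCompact_image (isCompact_Icc.image continuous_neg) hK hKE)
    (hΦ.image_subset (I := Neg.neg '' Icc 0 T) hKE)
  have h2 := (lintegral_rpow_enorm_lt_top_of_eLpNorm_lt_top (by norm_num) (by norm_num) hK'.2)
  simp only [ENNReal.toReal_ofNat] at h2
  have hmeas : Measurable fun q : V × ℝ => ‖u (Φ (-q.2) q.1)‖ₑ ^ (2 : ℝ) :=
    hF.comp ((hΦ.measurable hE).comp (measurable_snd.neg.prodMk measurable_fst))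
  have h3 := ae_lt_top (hmeas.lintegral_prod_right' (ν := volume.restrict (Ioc 0 T)))
    (h1.trans_lt (ENNReal.mul_lt_top ENNReal.ofReal_lt_top h2)).ne
  filter_upwards [h3] with x hx
  refine ⟨(hum.comp ((hΦ.measurable hE).comp
    (measurable_neg.prodMk measurable_const))).aestronglyMeasurable, ?_⟩
  rw [eLpNorm_lt_top_iff_lintegral_rpow_enorm_lt_top (by norm_num) (by norm_num)]
  simpa using hx

end IsFlowOn

namespace IsFlowOn

variable {V : Type*} [NormedAddCommGroup V] [NormedSpace ℝ V]
  {Φ : ℝ → V → V} {X : V → V} {E : Set V}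
  [FiniteDimensional ℝ V] [MeasurableSpace V] [BorelSpace V]
  {μ : Measure V} [SFinite μ] {u h w : V → ℂ}

theorem integrable_prod_orbit (hΦ : IsFlowOn Φ X E) (hE : IsOpen E)
    (hmp : ∀ t, MeasurePreserving (Φ t) μ μ) (hwm : Measurable w)
    (hw : ∀ K, IsCompact K → K ⊆ E → IntegrableOn w K μ) {c : ℝ → ℂ} (hc : Continuous c)
    (hc1 : ∀ s, ‖c s‖ ≤ 1) {K : Set V} (hK : IsCompact K) (hKE : K ⊆ E) (T : ℝ) :
    Integrable (fun q : V × ℝ => c q.2 * w (Φ (-q.2) q.1))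
      ((μ.restrict K).prod (volume.restrict (Ioc 0 T))) := by
  have hmeas : Measurable fun q : V × ℝ => w (Φ (-q.2) q.1) :=
    hwm.comp ((hΦ.measurable hE).comp (measurable_snd.neg.prodMk measurable_fst))
  have h1 : Integrable (fun q : V × ℝ => w (Φ (-q.2) q.1))
      ((μ.restrict K).prod (volume.restrict (Ioc 0 T))) := by
    refine ⟨hmeas.aestronglyMeasurable, ?_⟩
    rw [HasFiniteIntegral, lintegral_prod _ hmeas.enorm.aemeasurable]
    refine (hΦ.lintegral_lintegral_le hE hmp hwm.enorm hK hKE T).trans_lt ?_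
    refine ENNReal.mul_lt_top ENNReal.ofReal_lt_top ?_
    exact (hw _ (hΦ.isCompact_image (isCompact_Icc.image continuous_neg) hK hKE)
      (hΦ.image_subset hKE)).2
  exact h1.bdd_mul (c := 1) (hc.comp continuous_snd).aestronglyMeasurable
    (Filter.Eventually.of_forall fun q => hc1 _)

theorem locallyIntegrableOn_orbit (hΦ : IsFlowOn Φ X E) (hE : IsOpen E)
    (hmp : ∀ t, MeasurePreserving (Φ t) μ μ) (hwm : Measurable w)
    (hw : ∀ K, IsCompact K → K ⊆ E → IntegrableOn w K μ) {c : ℝ → ℂ} (hc : Continuous c)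
    (hc1 : ∀ s, ‖c s‖ ≤ 1) {T : ℝ} (hT : 0 ≤ T) :
    LocallyIntegrableOn (fun x => ∫ s in (0 : ℝ)..T, c s * w (Φ (-s) x)) E μ := by
  rw [locallyIntegrableOn_iff hE.isLocallyClosed]
  intro K hKE hK
  have := (hΦ.integrable_prod_orbit hE hmp hwm hw hc hc1 hK hKE T).integral_prod_left
  simpa only [intervalIntegral.integral_of_le hT, IntegrableOn] using this

/-- The substitution x ↦ Φ_{-s} x moves the flow from the test function onto `w`; this is why orbits
are followed backwards. -/
theorem integral_comp_eq (hΦ : IsFlowOn Φ X E) (hE : IsOpen E)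
    (hmp : ∀ t, MeasurePreserving (Φ t) μ μ) (hwm : Measurable w)
    (hw : ∀ K, IsCompact K → K ⊆ E → IntegrableOn w K μ) {c : ℝ → ℂ} (hc : Continuous c)
    (hc1 : ∀ s, ‖c s‖ ≤ 1) {T : ℝ} (hT : 0 ≤ T) {φ : V → ℝ} (hφ : IsTestOn φ E) :
    ∫ s in (0 : ℝ)..T, c s * ∫ x, w x * φ (Φ s x) ∂μ =
      ∫ x, φ x • (∫ s in (0 : ℝ)..T, c s * w (Φ (-s) x)) ∂μ := by
  have h0 : ∀ x ∉ tsupport φ, φ x = 0 := fun x hx => image_eq_zero_of_notMem_tsupport hx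
  have h1 : ∀ s, ∫ x, w x * φ (Φ s x) ∂μ = ∫ x in tsupport φ, w (Φ (-s) x) * φ x ∂μ := by
    intro s
    rw [setIntegral_eq_integral_of_forall_compl_eq_zero (fun x hx => by simp [h0 x hx])]
    have hf : Measurable fun y => w y * (φ (Φ s y) : ℂ) :=
      hwm.mul (measurable_ofReal.comp (hφ.contDiff.continuous.measurable.comp
        (hΦ.measurable_apply hE s)))
    have h2 := integral_map (μ := μ) (hmp (-s)).measurable.aemeasurable
      (f := fun y => w y * (φ (Φ s y) : ℂ)) hf.aestronglyMeasurable
    rw [(hmp (-s)).map_eq] at h2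
    simpa only [hΦ.apply_neg] using h2
  have hint := hΦ.integrable_prod_orbit hE hmp hwm hw hc hc1 hφ.hasCompactSupport
    hφ.tsupport_subset T
  obtain ⟨C, hC⟩ := hφ.hasCompactSupport.exists_bound_of_continuous hφ.contDiff.continuous
  have hint2 : Integrable (fun q : V × ℝ => (φ q.1 : ℂ) * (c q.2 * w (Φ (-q.2) q.1)))
      ((μ.restrict (tsupport φ)).prod (volume.restrict (Ioc 0 T))) :=
    hint.bdd_mul (c := C) (continuous_ofReal.comp (hφ.contDiff.continuous.comp
      continuous_fst)).aestronglyMeasurable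
      (Filter.Eventually.of_forall fun q => by rw [norm_real]; exact hC _)
  rw [← setIntegral_eq_integral_of_forall_compl_eq_zero (s := tsupport φ)
    (fun x hx => by simp [h0 x hx])]
  simp only [h1, intervalIntegral.integral_of_le hT, real_smul]
  simp only [← integral_const_mul]
  have h2 := integral_integral_swap
    (f := fun x s => (φ x : ℂ) * (c s * w (Φ (-s) x))) hint2
  rw [h2]
  refine integral_congr_ae (Filter.Eventually.of_forall fun s => ?_)
  refine integral_congr_ae (Filter.Eventually.of_forall fun x => ?_)
  ring

/-- Fourier coefficients along almost every orbit. -/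
theorem ae_fourier (hΦ : IsFlowOn Φ X E) (hE : IsOpen E) (hX : ContinuousOn X E)
    (hμE : μ Eᶜ = 0) (hmp : ∀ t, MeasurePreserving (Φ t) μ μ)
    (hum : Measurable u) (hhm : Measurable h)
    (hu : ∀ K, IsCompact K → K ⊆ E → IntegrableOn u K μ)
    (hh : ∀ K, IsCompact K → K ⊆ E → IntegrableOn h K μ)
    (huh : ∀ φ, IsTestOn φ E →
      ∫ x, u x * (fderiv ℝ φ x (X x) : ℂ) ∂μ = -∫ x, h x * (φ x : ℂ) ∂μ)
    {L : ℝ} (hL : 0 < L) (hper : ∀ x, Φ L x = x) {κ : ℝ} (hκ : exp (I * κ * L) = 1) :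
    ∀ᵐ x ∂μ, ∫ s in (0 : ℝ)..L, exp (I * κ * s) * h (Φ (-s) x) =
      I * κ * ∫ s in (0 : ℝ)..L, exp (I * κ * s) * u (Φ (-s) x) := by
  have hc : Continuous fun s : ℝ => exp (I * κ * s) := by fun_prop
  have hc1 : ∀ s : ℝ, ‖exp (I * κ * s)‖ ≤ 1 := fun s => by
    rw [mul_assoc, mul_comm, ← ofReal_mul, norm_exp_ofReal_mul_I]
  have hlh := hΦ.locallyIntegrableOn_orbit hE hmp hhm hh hc hc1 hL.le
  have hlu := hΦ.locallyIntegrableOn_orbit hE hmp hum hu hc hc1 hL.le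
  -- Both orbit integrals are locally integrable functions of the starting point, so their
  -- difference can be tested against smooth functions.
  have hae := hE.ae_eq_zero_of_integral_contDiff_smul_eq_zero
    (hlh.sub (hlu.smul (I * κ))) (fun φ hφ1 hφ2 hφ3 => ?_)
  · have hmem : ∀ᵐ x ∂μ, x ∈ E := by rw [ae_iff]; exact hμE
    filter_upwards [hae, hmem] with x hx hxE
    exact sub_eq_zero.1 (hx hxE)
  · have hφ : IsTestOn φ E := ⟨hφ1, hφ2, hφ3⟩
    have h1 := hΦ.integral_weak hE hX hμE hu huh hφ κ hL.le
    -- After a full period the boundary terms cancel, since Φ_L is the identity and e^{iκL} = 1.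
    simp only [hκ, hper, one_mul, sub_self, zero_sub, mul_neg, integral_neg, neg_neg] at h1
    have h2 : ∀ x, u x * (I * κ * ∫ s in (0 : ℝ)..L, exp (I * κ * s) * φ (Φ s x)) =
        I * κ * (u x * ∫ s in (0 : ℝ)..L, exp (I * κ * s) * φ (Φ s x)) := fun x => by ring
    simp only [h2] at h1
    rw [integral_const_mul, ← hΦ.integral_comp_swap hE hu hc hc1 hφ.contDiff.continuous
      hφ.hasCompactSupport hφ.tsupport_subset hL.le,
      hΦ.integral_comp_eq hE hmp hhm hh hc hc1 hL.le hφ,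
      hΦ.integral_comp_eq hE hmp hum hu hc hc1 hL.le hφ] at h1
    have hint : ∀ {f : V → ℂ}, LocallyIntegrableOn f E μ → Integrable (fun x => φ x • f x) μ := by
      intro f hf
      have h3 : IntegrableOn (fun x => φ x • f x) (tsupport φ) μ :=
        (hf.integrableOn_compact_subset hφ3 hφ2).continuousOn_smul
          hφ1.continuous.continuousOn hφ2
      rwa [integrableOn_iff_integrable_of_support_subset] at h3
      exact (Function.support_smul_subset_left φ f).trans (subset_tsupport φ)
    have h4 : ∀ x, φ x • ((fun x => ∫ s in (0 : ℝ)..L, exp (I * κ * s) * h (Φ (-s) x)) -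
        (I * κ) • (fun x => ∫ s in (0 : ℝ)..L, exp (I * κ * s) * u (Φ (-s) x))) x =
        φ x • (∫ s in (0 : ℝ)..L, exp (I * κ * s) * h (Φ (-s) x)) -
        I * κ * φ x • (∫ s in (0 : ℝ)..L, exp (I * κ * s) * u (Φ (-s) x)) := by
      intro x
      simp only [Pi.sub_apply, Pi.smul_apply, smul_sub, real_smul, smul_eq_mul]
      ring
    refine (integral_congr_ae (Filter.Eventually.of_forall h4)).trans ?_
    rw [integral_sub (hint hlh) ((hint hlu).const_mul _), integral_const_mul, h1, sub_self]

/-- The magnetic Hardy inequality along a periodic measure-preserving flow: the Fourier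
frequencies `2πn/L` which occur along the orbits are kept away from `-α`. -/
theorem hardy (hΦ : IsFlowOn Φ X E) (hE : IsOpen E) (hX : ContinuousOn X E)
    (hμE : μ Eᶜ = 0) (hμ : ∀ K, IsCompact K → K ⊆ E → μ K < ⊤)
    (hdiv : ∀ φ, IsTestOn φ E → ∫ x, fderiv ℝ φ x (X x) ∂μ = 0)
    (hum : Measurable u) (hhm : Measurable h)
    (hu : ∀ K, IsCompact K → K ⊆ E → MemLp u 2 (μ.restrict K))
    (hh : ∀ K, IsCompact K → K ⊆ E → MemLp h 2 (μ.restrict K))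
    (huh : ∀ φ, IsTestOn φ E →
      ∫ x, u x * (fderiv ℝ φ x (X x) : ℂ) ∂μ = -∫ x, h x * (φ x : ℂ) ∂μ)
    {L : ℝ} (hL : 0 < L) (hper : ∀ x, Φ L x = x) {α D : ℝ}
    (hD : ∀ x ∈ E, ∀ n : ℤ, (∃ p : ℝ, Φ p x = x ∧ exp (-(2 * Real.pi * I * n * p / L)) ≠ 1) ∨
      D ≤ (α + 2 * Real.pi * n / L) ^ 2) :
    ENNReal.ofReal D * ∫⁻ x, ENNReal.ofReal (‖u x‖ ^ 2) ∂μ ≤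
      ∫⁻ x, ENNReal.ofReal (‖I * h x + α * u x‖ ^ 2) ∂μ := by
  have hmp := hΦ.measurePreserving hE hX hμE hμ hdiv
  have hint : ∀ {w : V → ℂ}, (∀ K, IsCompact K → K ⊆ E → MemLp w 2 (μ.restrict K)) →
      ∀ K, IsCompact K → K ⊆ E → IntegrableOn w K μ := by
    intro w hw K hK hKE
    have : IsFiniteMeasure (μ.restrict K) :=
      ⟨by rw [Measure.restrict_apply_univ]; exact hμ K hK hKE⟩
    exact (hw K hK hKE).integrable (by norm_num)
  have hL0 : (L : ℂ) ≠ 0 := by exact_mod_cast hL.ne'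
  have hae : ∀ᵐ x ∂μ, ∀ n : ℤ,
      fourierCoeffOn hL (fun s => h (Φ (-s) x)) n =
        I * ((-(2 * Real.pi * n / L) : ℝ) : ℂ) * fourierCoeffOn hL (fun s => u (Φ (-s) x)) n := by
    rw [ae_all_iff]
    intro n
    have := hΦ.ae_fourier hE hX hμE hmp hum hhm (hint hu) (hint hh) huh hL hper
      (κ := -(2 * Real.pi * n / L)) (by
        rw [Complex.exp_eq_one_iff]
        exact ⟨-n, by push_cast; field_simp⟩)
    filter_upwards [this] with x hx
    have hf : ∀ s : ℝ, (fourier (-n) (s : AddCircle (L - 0)) : ℂ) =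
        exp (I * ((-(2 * Real.pi * n / L) : ℝ) : ℂ) * s) := by
      intro s
      rw [fourier_coe_apply]
      congr 1
      push_cast
      rw [sub_zero]
      ring
    simp only [fourierCoeffOn_eq_integral, hf, smul_eq_mul, hx, real_smul]
    ring
  have hmem : ∀ᵐ x ∂μ, x ∈ E := by rw [ae_iff]; exact hμE
  -- Parseval on almost every orbit. A mode `n` either is incompatible with an additional period of
  -- the orbit, so its coefficient vanishes, or obeys the spectral bound.
  have horb : ∀ᵐ x ∂μ, ENNReal.ofReal D * ∫⁻ s in Ioc 0 L, ENNReal.ofReal (‖u (Φ (-s) x)‖ ^ 2) ≤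
      ∫⁻ s in Ioc 0 L, ENNReal.ofReal (‖I * h (Φ (-s) x) + α * u (Φ (-s) x)‖ ^ 2) := by
    filter_upwards [hae, hmem, hΦ.ae_memLp_orbit hE hμE hmp hum hu L,
      hΦ.ae_memLp_orbit hE hμE hmp hhm hh L] with x hx hxE hux hhx
    have h1 := integral_sq_le_of_fourierCoeffOn hL hux hhx (α := α) (D := D) _ hx fun n => by
      rcases hD x hxE n with ⟨p, hp, hn⟩ | h2
      · left
        have hperiod : ∀ q, Φ q x = x → Function.Periodic (fun s => u (Φ (-s) x)) q := by
          intro q hq s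
          simp only
          congr 1
          have : Φ (-q) x = x := by
            conv_lhs => rw [← hq]
            exact hΦ.neg_apply q x
          rw [neg_add, hΦ.add, this]
        exact fourierCoeffOn_eq_zero_of_periodic hL (hperiod L (hper x)) (hperiod p hp) n hn
      · right
        rwa [sub_neg_eq_add]
    have hsum := (hhx.const_mul I).add (hux.const_mul (α : ℂ))
    have hlin : ∀ {f : ℝ → ℂ}, MemLp f 2 (volume.restrict (Ioc 0 L)) →
        ∫⁻ s in Ioc 0 L, ENNReal.ofReal (‖f s‖ ^ 2) =
          ENNReal.ofReal (∫ s in (0 : ℝ)..L, ‖f s‖ ^ 2) := by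
      intro f hf
      rw [intervalIntegral.integral_of_le hL.le,
        ofReal_integral_eq_lintegral_ofReal (hf.integrable_norm_pow (by norm_num))
          (Filter.Eventually.of_forall fun s => by positivity)]
    rw [hlin hux]
    refine le_trans ?_ (hlin hsum).ge
    rcases le_total D 0 with hD0 | hD0
    · simp [ENNReal.ofReal_of_nonpos hD0]
    · rw [← ENNReal.ofReal_mul hD0]
      exact ENNReal.ofReal_le_ofReal h1
  -- By invariance of the measure, integrating over orbits and then over all starting points counts
  -- every point with the same weight `L`; no transversal to the flow is needed.
  have havg : ∀ {F : V → ENNReal}, Measurable F →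
      ∫⁻ x, (∫⁻ s in Ioc 0 L, F (Φ (-s) x)) ∂μ = ENNReal.ofReal L * ∫⁻ x, F x ∂μ := by
    intro F hF
    have hmeas : Measurable fun q : V × ℝ => F (Φ (-q.2) q.1) :=
      hF.comp ((hΦ.measurable hE).comp (measurable_snd.neg.prodMk measurable_fst))
    rw [lintegral_lintegral_swap hmeas.aemeasurable]
    simp only [(hmp _).lintegral_comp hF]
    rw [setLIntegral_const, Real.volume_Ioc, sub_zero, mul_comm]
  have hF1 : Measurable fun x => ENNReal.ofReal (‖u x‖ ^ 2) := (hum.norm.pow_const 2).ennreal_ofReal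
  have hF2 : Measurable fun x => ENNReal.ofReal (‖I * h x + α * u x‖ ^ 2) :=
    (((hhm.const_mul I).add (hum.const_mul (α : ℂ))).norm.pow_const 2).ennreal_ofReal
  have hfin := lintegral_mono_ae horb
  rw [lintegral_const_mul' _ _ ENNReal.ofReal_ne_top, havg hF1, havg hF2, mul_left_comm] at hfin
  exact (ENNReal.mul_le_mul_iff_right (by simpa using hL) ENNReal.ofReal_ne_top).1 hfin

end IsFlowOn

/-! ### The polynomial map: differential, properness, critical values and fibres. -/

section PolyMap

variable {ι : Type*} [Fintype ι] [DecidableEq ι]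

/-- The polynomial `∏_{k ≠ j} (z - x_k)`. -/
def nodePoly (j : ι) (x : ι → ℂ) : Polynomial ℂ :=
  ∏ k ∈ Finset.univ.erase j, (Polynomial.X - Polynomial.C (x k))

/-- The map replacing the coordinate `x_j` by `∏_{k ≠ j} (x_j - x_k)`. -/
def polyMap (j : ι) (x : ι → ℂ) : ι → ℂ :=
  Function.update x j (∏ k ∈ Finset.univ.erase j, (x j - x k))

/-- The points where `x_j` is a critical point of the polynomial `∏_{k ≠ j} (z - x_k)`. -/
def critSet (j : ι) : Set (ι → ℂ) := {x | (nodePoly j x).derivative.eval (x j) = 0}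

/-- Multiplication of the coordinate `j` by `w`. -/
def rotAt (j : ι) (w : ℂ) (y : ι → ℂ) : ι → ℂ := Function.update y j (w * y j)

theorem continuous_rotAt {ι : Type*} [DecidableEq ι] (j : ι) : Continuous fun q : ℂ × (ι → ℂ) => rotAt j q.1 q.2 := by
  unfold rotAt
  exact continuous_snd.update j (continuous_fst.mul ((continuous_apply j).comp continuous_snd))

theorem rotAt_rotAt {ι : Type*} [DecidableEq ι] (j : ι) (w w' : ℂ) (y : ι → ℂ) : rotAt j w (rotAt j w' y) = rotAt j (w * w') y := by
  simp [rotAt, mul_assoc]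

theorem rotAt_one {ι : Type*} [DecidableEq ι] (j : ι) (y : ι → ℂ) : rotAt j 1 y = y := by simp [rotAt]

/-- The points `y` such that the circle of radius `|y_j|` contains no critical value, and such
that the other coordinates are pairwise distinct. -/
def regularValues (j : ι) : Set (ι → ℂ) :=
  {y | y j ≠ 0} ∩ {y | ∀ k l, k ≠ j → l ≠ j → k ≠ l → y k ≠ y l} ∩
    {y | ∀ w : Circle, rotAt j w y ∉ polyMap j '' critSet j}

/-- The vector field generating the flow that rotates `∏_{k ≠ j} (x_j - x_k)`. -/
def rotField (j : ι) (x : ι → ℂ) : ι → ℂ :=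
  Pi.single j (I / ∑ k ∈ Finset.univ.erase j, (x j - x k)⁻¹)

variable (j : ι)

theorem polyMap_self (x : ι → ℂ) : polyMap j x j = ∏ k ∈ Finset.univ.erase j, (x j - x k) := by
  simp [polyMap]

theorem polyMap_of_ne (x : ι → ℂ) {k : ι} (hk : k ≠ j) : polyMap j x k = x k := by
  simp [polyMap, hk]

theorem eval_nodePoly (x : ι → ℂ) (z : ℂ) :
    (nodePoly j x).eval z = ∏ k ∈ Finset.univ.erase j, (z - x k) := by
  simp [nodePoly, Polynomial.eval_prod]

theorem nodePoly_congr {x y : ι → ℂ} (h : ∀ k, k ≠ j → x k = y k) :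
    nodePoly j x = nodePoly j y :=
  Finset.prod_congr rfl fun k hk => by rw [h k (Finset.ne_of_mem_erase hk)]

theorem natDegree_nodePoly (x : ι → ℂ) : (nodePoly j x).natDegree = Fintype.card ι - 1 := by
  rw [nodePoly, Polynomial.natDegree_finsetProd_X_sub_C_eq_card]
  simp

theorem contDiff_polyMap : ContDiff ℂ ∞ (polyMap j) := by
  rw [contDiff_pi]
  intro k
  by_cases hk : k = j
  · subst hk
    simp only [polyMap_self]
    exact contDiff_prod fun i _ => by fun_prop
  · simp only [polyMap_of_ne _ _ hk]
    fun_prop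

theorem polyMap_update (x : ι → ℂ) (z : ℂ) :
    polyMap j (Function.update x j z) = Function.update x j ((nodePoly j x).eval z) := by
  ext k
  by_cases hk : k = j
  · subst hk
    rw [polyMap_self, eval_nodePoly, Function.update_self, Function.update_self]
    exact Finset.prod_congr rfl fun i hi => by
      rw [Function.update_of_ne (Finset.ne_of_mem_erase hi)]
  · rw [polyMap_of_ne _ _ hk, Function.update_of_ne hk, Function.update_of_ne hk]

/-- Together with `fderiv_polyMap_of_ne` this makes the differential triangular: P'(x_j) in
direction `j`, the identity in the other components. It degenerates exactly on `critSet j`. -/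
theorem fderiv_polyMap_single (x : ι → ℂ) (c : ℂ) :
    fderiv ℂ (polyMap j) x (Pi.single j c) =
      Pi.single j ((nodePoly j x).derivative.eval (x j) * c) := by
  have h1 : HasDerivAt (fun z => polyMap j (Function.update x j z))
      (fderiv ℂ (polyMap j) x (Pi.single j 1)) (x j) := by
    have h2 : HasFDerivAt (polyMap j) (fderiv ℂ (polyMap j) x) (Function.update x j (x j)) := by
      rw [Function.update_eq_self]
      exact ((contDiff_polyMap j).differentiable (by simp) x).hasFDerivAt
    exact h2.comp_hasDerivAt (x j) (hasDerivAt_update x j (x j))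
  have h3 : HasDerivAt (fun z => polyMap j (Function.update x j z))
      ((nodePoly j x).derivative.eval (x j) • Pi.single j (1 : ℂ)) (x j) := by
    simp only [polyMap_update]
    exact (hasDerivAt_update x j _).scomp (x j) ((nodePoly j x).hasDerivAt (x j))
  have h4 : (Pi.single j c : ι → ℂ) = c • Pi.single j 1 := by
    rw [← Pi.single_smul, smul_eq_mul, mul_one]
  rw [h4, map_smul, h1.unique h3, ← Pi.single_smul, ← Pi.single_smul]
  simp [mul_comm]

theorem fderiv_polyMap_of_ne (x v : ι → ℂ) {k : ι} (hk : k ≠ j) :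
    fderiv ℂ (polyMap j) x v k = v k := by
  have h1 : HasFDerivAt (polyMap j) (fderiv ℂ (polyMap j) x) x :=
    ((contDiff_polyMap j).differentiable (by simp) x).hasFDerivAt
  have h2 := hasFDerivAt_pi'.1 h1 k
  simp only [polyMap_of_ne _ _ hk] at h2
  have h3 := h2.unique (hasFDerivAt_apply k x)
  exact congrArg (fun f => f v) h3

/-- The local inverse of `polyMap` at a noncritical point. -/
theorem exists_local_inverse {x : ι → ℂ} (hx : x ∉ critSet j) :
    ∃ φ : OpenPartialHomeomorph (ι → ℂ) (ι → ℂ), x ∈ φ.source ∧ (φ : (ι → ℂ) → ι → ℂ) = polyMap j ∧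
      ContDiffAt ℂ ∞ φ.symm (polyMap j x) := by
  -- A kernel vector has only a `j`-component, and that component is multiplied by P'(x_j) ≠ 0.
  have hinj : Function.Injective (fderiv ℂ (polyMap j) x : (ι → ℂ) →ₗ[ℂ] (ι → ℂ)) := by
    rw [← LinearMap.ker_eq_bot, LinearMap.ker_eq_bot']
    intro v hv
    have hv' : fderiv ℂ (polyMap j) x v = 0 := hv
    have h1 : v = Pi.single j (v j) := by
      ext k
      by_cases hk : k = j
      · subst hk; simp
      · rw [Pi.single_eq_of_ne hk, ← fderiv_polyMap_of_ne j x v hk, hv', Pi.zero_apply]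
    rw [h1, fderiv_polyMap_single, Pi.single_eq_zero_iff] at hv'
    rw [h1, (mul_eq_zero.1 hv').resolve_left hx, Pi.single_zero]
  set e := (LinearEquiv.ofInjectiveEndo _ hinj).toContinuousLinearEquiv with he
  have hf' : HasFDerivAt (polyMap j) (e : (ι → ℂ) →L[ℂ] (ι → ℂ)) x := by
    have he2 : (e : (ι → ℂ) →L[ℂ] (ι → ℂ)) = fderiv ℂ (polyMap j) x := by ext v k; rfl
    rw [he2]
    exact ((contDiff_polyMap j).differentiable (by simp) x).hasFDerivAt
  have hc := (contDiff_polyMap j).contDiffAt (x := x)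
  exact ⟨hc.toOpenPartialHomeomorph _ hf' (by simp),
    hc.mem_toOpenPartialHomeomorph_source hf' (by simp), rfl, hc.to_localInverse hf' (by simp)⟩

/-- If the image is bounded by `R`, so are the x_k with k ≠ j. If moreover |x_j| > 2R + 1, every
factor x_j - x_k would have modulus at least R + 1, and the nonempty product would exceed `R`. -/
theorem isProperMap_polyMap [Nontrivial ι] : IsProperMap (polyMap j) := by
  rw [isProperMap_iff_isCompact_preimage]
  refine ⟨(contDiff_polyMap j).continuous, fun K hK => ?_⟩
  obtain ⟨R, hR0, hR⟩ := hK.isBounded.exists_pos_norm_le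
  refine (isCompact_closedBall (0 : ι → ℂ) (2 * R + 1)).of_isClosed_subset
    (hK.isClosed.preimage (contDiff_polyMap j).continuous) fun x hx => ?_
  have hk : ∀ k, ‖polyMap j x k‖ ≤ R := fun k => (norm_le_pi_norm _ k).trans (hR _ hx)
  have hk' : ∀ k, k ≠ j → ‖x k‖ ≤ R := fun k hkj => by
    have := hk k
    rwa [polyMap_of_ne _ _ hkj] at this
  rw [mem_closedBall_zero_iff, pi_norm_le_iff_of_nonneg (by positivity)]
  intro k
  by_cases hkj : k = j
  · subst hkj
    by_contra! hlt
    have h1 : ∀ i ∈ Finset.univ.erase k, R + 1 ≤ ‖x k - x i‖ := fun i hi => by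
      have := norm_sub_norm_le (x k) (x i)
      linarith [hk' i (Finset.ne_of_mem_erase hi)]
    have h2 := Finset.prod_le_prod (fun i _ => by positivity) h1
    rw [← norm_prod, ← polyMap_self, Finset.prod_const] at h2
    have h3 : (Finset.univ.erase k).card ≠ 0 := by
      rw [Finset.card_erase_of_mem (Finset.mem_univ _), Finset.card_univ]
      have := Fintype.one_lt_card (α := ι)
      omega
    have h4 := le_self_pow₀ (a := R + 1) (by linarith) h3
    linarith [hk k]
  · linarith [hk' k hkj]

theorem isClosed_critSet : IsClosed (critSet j) := by
  have : critSet j = {x | fderiv ℂ (polyMap j) x (Pi.single j 1) j = 0} := by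
    ext x
    simp [critSet, fderiv_polyMap_single]
  rw [this]
  have h1 : Continuous fun x => fderiv ℂ (polyMap j) x :=
    (contDiff_polyMap j).continuous_fderiv (by simp)
  exact isClosed_eq ((continuous_apply j).comp (h1.clm_apply continuous_const)) continuous_const

/-- The critical values form a closed set because a proper map is closed, and the union of its
rotates is closed because the circle is compact. -/
theorem isOpen_regularValues [Nontrivial ι] : IsOpen (regularValues j) := by
  refine (IsOpen.inter ?_ ?_).inter ?_
  · exact isOpen_ne_fun (continuous_apply j) continuous_const
  · simp only [ofPred_forall]
    refine isOpen_iInter_of_finite fun k => isOpen_iInter_of_finite fun l =>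
      isOpen_iInter_of_finite fun _ => isOpen_iInter_of_finite fun _ =>
      isOpen_iInter_of_finite fun _ => isOpen_ne_fun (continuous_apply k) (continuous_apply l)
  · have hcl : IsClosed (polyMap j '' critSet j) :=
      (isProperMap_polyMap j).isClosedMap _ (isClosed_critSet j)
    have h1 : IsClosed {q : Circle × (ι → ℂ) | rotAt j q.1 q.2 ∈ polyMap j '' critSet j} :=
      hcl.preimage ((continuous_rotAt j).comp
        (f := fun q : Circle × (ι → ℂ) => ((q.1 : ℂ), q.2)) (by fun_prop))
    have h2 := (isClosedMap_snd_of_compactSpace (X := Circle) (Y := ι → ℂ) _ h1).isOpen_compl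
    convert h2 using 1
    ext y
    simp

theorem rotAt_mem_regularValues (w : Circle) {y : ι → ℂ} (hy : y ∈ regularValues j) :
    rotAt j w y ∈ regularValues j := by
  obtain ⟨⟨h1, h2⟩, h3⟩ := hy
  refine ⟨⟨?_, ?_⟩, ?_⟩
  · simpa [rotAt] using h1
  · intro k l hk hl hkl
    simpa [rotAt, hk, hl] using h2 k l hk hl hkl
  · intro w'
    rw [rotAt_rotAt, ← Circle.coe_mul]
    exact h3 _

theorem notMem_critSet {x : ι → ℂ} (hx : polyMap j x ∈ regularValues j) : x ∉ critSet j := by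
  intro h
  have := hx.2 1
  rw [Circle.coe_one, rotAt_one] at this
  exact this ⟨x, h, rfl⟩

theorem fibre_subset [Nontrivial ι] (y : ι → ℂ) : polyMap j ⁻¹' {y} ⊆
    Function.update y j '' ((nodePoly j y - Polynomial.C (y j)).roots.toFinset : Set ℂ) := by
  intro x hx
  have hx' : polyMap j x = y := hx
  have h1 : ∀ k, k ≠ j → x k = y k := fun k hk => by rw [← hx', polyMap_of_ne _ _ hk]
  refine ⟨x j, ?_, ?_⟩
  · simp only [Finset.mem_coe, Multiset.mem_toFinset]
    rw [Polynomial.mem_roots', Polynomial.IsRoot]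
    constructor
    · intro h
      have h2 := congrArg Polynomial.natDegree h
      rw [Polynomial.natDegree_sub_C, natDegree_nodePoly, Polynomial.natDegree_zero] at h2
      have := Fintype.one_lt_card (α := ι)
      omega
    · rw [Polynomial.eval_sub, Polynomial.eval_C, ← nodePoly_congr j h1, eval_nodePoly,
        ← polyMap_self, hx', sub_self]
  · ext k
    by_cases hk : k = j
    · subst hk; simp
    · rw [Function.update_of_ne hk, h1 k hk]

theorem finite_fibre [Nontrivial ι] (y : ι → ℂ) : (polyMap j ⁻¹' {y}).Finite :=
  ((Finset.finite_toSet _).image _).subset (fibre_subset j y)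

/-- Points of the fibre correspond to roots of P - y_j, of degree N - 1. This is the source of the
range l ≤ N - 1 in the Hardy constant. -/
theorem ncard_fibre_le [Nontrivial ι] (y : ι → ℂ) :
    (polyMap j ⁻¹' {y}).ncard ≤ Fintype.card ι - 1 := by
  refine (ncard_le_ncard (fibre_subset j y) ((Finset.finite_toSet _).image _)).trans ?_
  refine (ncard_image_le (Finset.finite_toSet _)).trans ?_
  rw [ncard_coe_finset]
  refine (Multiset.toFinset_card_le _).trans ((Polynomial.card_roots' _).trans ?_)
  rw [Polynomial.natDegree_sub_C, natDegree_nodePoly]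

end PolyMap

/-! ### Lifting the rotation to a flow, and the periods of its orbits. -/

/-- Flows lift to covering spaces. -/
theorem exists_lift_flow {E B : Type*} [TopologicalSpace E] [TopologicalSpace B] {p : E → B}
    (cov : IsCoveringMap p) {R : ℝ → B → B} (hR : Continuous fun q : ℝ × B => R q.1 q.2)
    (hR0 : ∀ y, R 0 y = y) (hRadd : ∀ s t y, R (s + t) y = R s (R t y)) :
    ∃ Ψ : ℝ → E → E, (Continuous fun q : ℝ × E => Ψ q.1 q.2) ∧
      (∀ t x, p (Ψ t x) = R t (p x)) ∧ (∀ x, Ψ 0 x = x) ∧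
      ∀ s t x, Ψ (s + t) x = Ψ s (Ψ t x) := by
  have hp := cov.continuous
  -- For each (t, x) the homotopy traverses the path s ↦ R_{st}(p x); the endpoint of its lift
  -- starting at x serves as Ψ_t x.
  let H : C(unitInterval × (ℝ × E), B) :=
    ⟨fun q => R (q.1 * q.2.1) (p q.2.2), hR.comp
      (f := fun q : unitInterval × (ℝ × E) => ((q.1 : ℝ) * q.2.1, p q.2.2)) (by fun_prop)⟩
  let f : C(ℝ × E, E) := ⟨Prod.snd, continuous_snd⟩
  have H0 : ∀ a, H (0, a) = p (f a) := fun a => by simp [H, f, hR0]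
  let G := cov.liftHomotopy H f H0
  have hG : ∀ q, p (G q) = H q := fun q => congrFun (cov.liftHomotopy_lifts H f H0) q
  have hG0 : ∀ a, G (0, a) = f a := cov.liftHomotopy_zero H f H0
  have hcont : Continuous fun q : ℝ × E => G (1, (q.1, q.2)) := G.continuous.comp (by fun_prop)
  have hlift : ∀ t x, p (G (1, (t, x))) = R t (p x) := fun t x => by
    rw [hG]
    simp [H]
  have hzero : ∀ x, G (1, ((0 : ℝ), x)) = x := by
    intro x
    have := cov.eq_of_comp_eq (A := unitInterval) (g₁ := fun s => G (s, ((0 : ℝ), x)))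
      (g₂ := fun _ => x) (G.continuous.comp (by fun_prop)) continuous_const
      (by ext s; simp [hG, H, hR0]) 0 (hG0 _)
    exact congrFun this 1
  refine ⟨fun t x => G (1, (t, x)), hcont, hlift, hzero, fun s t x => ?_⟩
  -- Both sides, as functions of `s`, lift s ↦ R_{s+t}(p x) and agree at s = 0; uniqueness of lifts
  -- gives the group law.
  have := cov.eq_of_comp_eq (A := ℝ) (g₁ := fun s => G (1, (s + t, x)))
    (g₂ := fun s => G (1, (s, G (1, (t, x))))) (G.continuous.comp (by fun_prop))
    (G.continuous.comp (by fun_prop))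
    (by ext s; simp only [Function.comp_apply, hlift, hRadd]) 0 (by simp [hzero])
  exact congrFun this s

section PolyMap

variable {ι : Type*} [Fintype ι] [DecidableEq ι] (j : ι)

/-- The set on which the rotation flow is defined. -/
def regularSet (j : ι) : Set (ι → ℂ) := polyMap j ⁻¹' regularValues j

variable {j}

theorem ne_of_mem_regularSet {x : ι → ℂ} (hx : x ∈ regularSet j) {k : ι} (hk : k ≠ j) :
    x j - x k ≠ 0 := by
  have h1 : polyMap j x j ≠ 0 := hx.1.1
  rw [polyMap_self, Finset.prod_ne_zero_iff] at h1
  exact h1 k (Finset.mem_erase.2 ⟨hk, Finset.mem_univ k⟩)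

theorem injective_of_mem_regularSet {x : ι → ℂ} (hx : x ∈ regularSet j) :
    Function.Injective x := by
  intro k l hkl
  by_contra hne
  by_cases hk : k = j
  · subst hk
    exact ne_of_mem_regularSet hx (Ne.symm hne) (sub_eq_zero.2 hkl)
  · by_cases hl : l = j
    · subst hl
      exact ne_of_mem_regularSet hx hk (sub_eq_zero.2 hkl.symm)
    · have := hx.1.2 k l hk hl hne
      rw [polyMap_of_ne _ _ hk, polyMap_of_ne _ _ hl] at this
      exact this hkl

/-- The logarithmic derivative of P is the field sum, so on `regularSet j` noncritical points are
those where the field does not vanish. -/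
theorem eval_derivative_nodePoly {x : ι → ℂ} (hx : x ∈ regularSet j) :
    (nodePoly j x).derivative.eval (x j) =
      polyMap j x j * ∑ k ∈ Finset.univ.erase j, (x j - x k)⁻¹ := by
  rw [nodePoly, Polynomial.derivative_prod_finset, Polynomial.eval_finsetSum, polyMap_self,
    Finset.mul_sum]
  refine Finset.sum_congr rfl fun k hk => ?_
  rw [← Finset.mul_prod_erase _ _ hk]
  have := ne_of_mem_regularSet hx (Finset.ne_of_mem_erase hk)
  simp only [Polynomial.derivative_sub, Polynomial.derivative_X, Polynomial.derivative_C, sub_zero,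
    mul_one, Polynomial.eval_prod, Polynomial.eval_sub, Polynomial.eval_X, Polynomial.eval_C]
  field_simp

theorem sum_inv_ne_zero {x : ι → ℂ} (hx : x ∈ regularSet j) :
    ∑ k ∈ Finset.univ.erase j, (x j - x k)⁻¹ ≠ 0 := by
  intro h
  apply notMem_critSet j hx
  rw [critSet, mem_ofPred_eq, eval_derivative_nodePoly hx, h, mul_zero]

theorem isOpen_regularSet [Nontrivial ι] : IsOpen (regularSet j) :=
  (isOpen_regularValues j).preimage (contDiff_polyMap j).continuous

theorem continuousOn_rotField : ContinuousOn (rotField j) (regularSet j) := by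
  have : ContinuousOn (fun x : ι → ℂ => I / ∑ k ∈ Finset.univ.erase j, (x j - x k)⁻¹)
      (regularSet j) := by
    refine continuousOn_const.div (continuousOn_finsetSum _ fun k hk => ?_)
      fun x hx => sum_inv_ne_zero hx
    exact ContinuousOn.inv₀ (by fun_prop) fun x hx =>
      ne_of_mem_regularSet hx (Finset.ne_of_mem_erase hk)
  unfold rotField
  exact (continuous_single j).comp_continuousOn this

/-- The flow that rotates the polynomial `∏_{k ≠ j} (x_j - x_k)`. -/
theorem exists_rotFlow [Nontrivial ι] (j : ι) : ∃ Φ : ℝ → (ι → ℂ) → (ι → ℂ),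
    IsFlowOn Φ (rotField j) (regularSet j) ∧
    ∀ t, ∀ x ∈ regularSet j, polyMap j (Φ t x) = rotAt j (exp (I * t)) (polyMap j x) := by
  classical
  have cov : IsCoveringMap
      (fun x : regularSet j => (⟨polyMap j x, x.2⟩ : regularValues j)) := by
    -- A closed local homeomorphism with finite fibres is a covering.
    have h : IsCoveringMapOn (polyMap j) (regularValues j) := by
      refine (isProperMap_polyMap j).isClosedMap.isCoveringMapOn_of_isLocalHomeomorphOn
        (fun y _ => finite_fibre j y) fun x hx => ?_
      obtain ⟨φ, h1, h2, -⟩ := exists_local_inverse j (notMem_critSet j hx)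
      exact ⟨φ, h1, h2.symm⟩
    exact h.isCoveringMap_restrictPreimage
  have hcirc : ∀ t : ℝ, exp (I * t) = (Circle.exp t : ℂ) := fun t => by
    rw [Circle.coe_exp, mul_comm]
  let R : ℝ → regularValues j → regularValues j := fun t y =>
    ⟨rotAt j (exp (I * t)) y, by rw [hcirc]; exact rotAt_mem_regularValues j _ y.2⟩
  obtain ⟨Ψ, hΨc, hΨp, hΨ0, hΨadd⟩ := exists_lift_flow cov (R := R)
    (((continuous_rotAt j).comp (f := fun q : ℝ × regularValues j => (exp (I * q.1), (q.2 : ι → ℂ)))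
      (by fun_prop)).subtype_mk _)
    (fun y => Subtype.ext (by simp [R, rotAt_one]))
    (fun s t y => Subtype.ext (by
      simp only [R, rotAt_rotAt, ← Complex.exp_add]
      push_cast
      rw [mul_add]))
  let Φ : ℝ → (ι → ℂ) → (ι → ℂ) := fun t x => if h : x ∈ regularSet j then Ψ t ⟨x, h⟩ else x
  have hΦ : ∀ t (x : regularSet j), Φ t x = Ψ t x := fun t x => dif_pos x.2
  have hpoly : ∀ t, ∀ x ∈ regularSet j, polyMap j (Φ t x) = rotAt j (exp (I * t)) (polyMap j x) := by
    intro t x hx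
    rw [hΦ t ⟨x, hx⟩]
    exact congrArg Subtype.val (hΨp t ⟨x, hx⟩)
  have hmaps : ∀ t x, x ∈ regularSet j → Φ t x ∈ regularSet j := fun t x hx => by
    rw [hΦ t ⟨x, hx⟩]
    exact (Ψ t ⟨x, hx⟩).2
  have hcont : ContinuousOn (fun q : ℝ × (ι → ℂ) => Φ q.1 q.2) (univ ×ˢ regularSet j) := by
    rw [continuousOn_iff_continuous_domRestrict]
    have h1 : Continuous fun q : (univ ×ˢ regularSet j : Set (ℝ × (ι → ℂ))) =>
        (Ψ q.1.1 ⟨q.1.2, (mem_prod.1 q.2).2⟩ : ι → ℂ) :=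
      continuous_subtype_val.comp (hΨc.comp
        (f := fun q : (univ ×ˢ regularSet j : Set (ℝ × (ι → ℂ))) =>
          (q.1.1, (⟨q.1.2, (mem_prod.1 q.2).2⟩ : regularSet j))) (by fun_prop))
    convert h1 using 1
    ext q k
    rw [Set.domRestrict_apply, hΦ q.1.1 ⟨q.1.2, (mem_prod.1 q.2).2⟩]
  have hopen : IsOpen (regularSet j) := isOpen_regularSet
  refine ⟨Φ, ⟨hmaps, fun t x hx => dif_neg hx, ?_, ?_, hcont, ?_, ?_⟩, hpoly⟩
  · intro x
    by_cases hx : x ∈ regularSet j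
    · rw [hΦ 0 ⟨x, hx⟩, hΨ0]
    · exact dif_neg hx
  · intro s t x
    by_cases hx : x ∈ regularSet j
    · rw [hΦ (s + t) ⟨x, hx⟩, hΦ t ⟨x, hx⟩, hΨadd, hΦ]
    · have : ∀ t, Φ t x = x := fun t => dif_neg hx
      simp only [this]
  · intro t x hx
    obtain ⟨φ, h1, h2, h3⟩ := exists_local_inverse j (notMem_critSet j (hmaps t x hx))
    have hct : ContinuousAt (Φ t) x :=
      (hcont.comp (f := fun x => (t, x)) (by fun_prop) fun y hy => ⟨mem_univ _, hy⟩).continuousAt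
        (hopen.mem_nhds hx)
    -- Locally the flow is a smooth inverse branch of `polyMap` composed with the rotation and
    -- `polyMap`.
    have hev : Φ t =ᶠ[𝓝 x] fun y => φ.symm (rotAt j (exp (I * t)) (polyMap j y)) := by
      filter_upwards [hopen.mem_nhds hx, hct (φ.open_source.mem_nhds h1)] with y hy hys
      rw [← hpoly t y hy, ← h2]
      exact (φ.left_inv hys).symm
    refine (ContDiffAt.congr_of_eventuallyEq ?_ hev).contDiffWithinAt
    rw [hpoly t x hx] at h3
    have h4 : ContDiff ℂ ∞ fun y => rotAt j (exp (I * t)) (polyMap j y) := by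
      have hp := contDiff_pi.1 (contDiff_polyMap j)
      rw [contDiff_pi]
      intro k
      by_cases hk : k = j
      · subst hk
        simp only [rotAt, Function.update_self]
        exact contDiff_const.mul (hp k)
      · simpa only [rotAt, Function.update_of_ne hk] using hp k
    exact (h3.comp x h4.contDiffAt).restrict_scalars ℝ
  · intro t x hx
    have hxt := hmaps t x hx
    obtain ⟨φ, h1, h2, h3⟩ := exists_local_inverse j (notMem_critSet j hxt)
    have hct : ContinuousAt (fun s => Φ s x) t :=
      (hcont.comp_continuous (f := fun s : ℝ => (s, x)) (by fun_prop)
        fun s => ⟨mem_univ _, hx⟩).continuousAt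
    have hev : (fun s => Φ s x) =ᶠ[𝓝 t] fun s => φ.symm (rotAt j (exp (I * s)) (polyMap j x)) := by
      filter_upwards [hct (φ.open_source.mem_nhds h1)] with s hs
      rw [← hpoly s x hx, ← h2]
      exact (φ.left_inv hs).symm
    have hrot : HasDerivAt (fun s : ℝ => rotAt j (exp (I * s)) (polyMap j x))
        (Pi.single j (I * polyMap j (Φ t x) j)) t := by
      have h5 : HasDerivAt (fun s : ℝ => exp (I * s) * polyMap j x j)
          (I * polyMap j (Φ t x) j) t := by
        have h6 : HasDerivAt (fun s : ℝ => I * (s : ℂ)) I t := by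
          simpa using (ofRealCLM.hasDerivAt (x := t)).const_mul I
        have h7 := h6.cexp.mul_const (polyMap j x j)
        refine h7.congr_deriv ?_
        rw [hpoly t x hx]
        simp only [rotAt, Function.update_self]
        ring
      have h8 := (hasDerivAt_update (𝕜 := ℂ) (polyMap j x) j
        (exp (I * t) * polyMap j x j)).scomp t h5
      simp only [← Pi.single_smul, smul_eq_mul, mul_one] at h8
      exact h8
    have hdiff : DifferentiableAt ℝ (fun s => Φ s x) t := by
      refine DifferentiableAt.congr_of_eventuallyEq ?_ hev
      rw [hpoly t x hx] at h3
      exact DifferentiableAt.comp t (g := φ.symm)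
        ((h3.restrict_scalars ℝ).differentiableAt (by simp)) hrot.differentiableAt
    -- Differentiability being known, the velocity is found by pushing it through `polyMap`: P'(x_j)
    -- v_j = i P(x_j), the other components of v vanish, and v_j = i/(P'/P).
    obtain ⟨v, hv⟩ : ∃ v, HasDerivAt (fun s => Φ s x) v t := ⟨_, hdiff.hasDerivAt⟩
    have hp : HasFDerivAt (polyMap j) ((fderiv ℂ (polyMap j) (Φ t x)).restrictScalars ℝ) (Φ t x) :=
      ((contDiff_polyMap j).differentiable (by simp) _).hasFDerivAt.restrictScalars ℝ
    have h9 := hp.comp_hasDerivAt t hv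
    have h10 : (polyMap j ∘ fun s => Φ s x) = fun s : ℝ => rotAt j (exp (I * s)) (polyMap j x) :=
      funext fun s => hpoly s x hx
    rw [h10] at h9
    have h11 := h9.unique hrot
    rw [ContinuousLinearMap.coe_restrictScalars'] at h11
    have h12 : v = Pi.single j (v j) := by
      ext k
      by_cases hk : k = j
      · subst hk; simp
      · rw [Pi.single_eq_of_ne hk, ← fderiv_polyMap_of_ne j (Φ t x) v hk, h11,
          Pi.single_eq_of_ne hk]
    rw [h12, fderiv_polyMap_single, eval_derivative_nodePoly hxt] at h11
    have h13 := Pi.single_injective (M := fun _ => ℂ) j h11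
    have h14 : polyMap j (Φ t x) j ≠ 0 := hxt.1.1
    have h15 : v j = I / ∑ k ∈ Finset.univ.erase j, (Φ t x j - Φ t x k)⁻¹ := by
      rw [eq_div_iff (sum_inv_ne_zero hxt)]
      apply mul_left_cancel₀ h14
      linear_combination h13
    rw [rotField, ← h15, ← h12]
    exact hv

/-- Every orbit of the rotation flow closes up after at most `card ι - 1` turns. -/
theorem exists_period [Nontrivial ι] {Φ : ℝ → (ι → ℂ) → (ι → ℂ)} {X : (ι → ℂ) → (ι → ℂ)}
    (hΦ : IsFlowOn Φ X (regularSet j))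
    (hpoly : ∀ t, ∀ x ∈ regularSet j, polyMap j (Φ t x) = rotAt j (exp (I * t)) (polyMap j x))
    {x : ι → ℂ} (hx : x ∈ regularSet j) :
    ∃ l ∈ Finset.Icc 1 (Fintype.card ι - 1), Φ (2 * Real.pi * (l : ℕ)) x = x := by
  have hfib : ∀ m : ℕ, Φ (2 * Real.pi * m) x ∈ polyMap j ⁻¹' {polyMap j x} := by
    intro m
    rw [mem_preimage, hpoly _ x hx, mem_singleton_iff]
    have : exp (I * ((2 * Real.pi * m : ℝ) : ℂ)) = 1 :=
      Complex.exp_eq_one_iff.2 ⟨m, by push_cast; ring⟩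
    rw [this, rotAt_one]
  -- Pigeonhole: the N points reached after 0, …, N - 1 full turns lie in a fibre with at most N - 1
  -- elements.
  obtain ⟨a, ha, b, hb, hab, heq⟩ := Finset.exists_ne_map_eq_of_card_lt_of_maps_to
    (s := Finset.range (Fintype.card ι)) (t := (finite_fibre j (polyMap j x)).toFinset)
    (f := fun m : ℕ => Φ (2 * Real.pi * m) x) (by
      rw [← ncard_eq_toFinset_card _ (finite_fibre j (polyMap j x)), Finset.card_range]
      have := ncard_fibre_le j (polyMap j x)
      have := Fintype.one_lt_card (α := ι)
      omega) (fun m _ => by simpa using hfib m)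
  have key : ∀ a b : ℕ, a < b → b < Fintype.card ι →
      Φ (2 * Real.pi * a) x = Φ (2 * Real.pi * b) x →
      ∃ l ∈ Finset.Icc 1 (Fintype.card ι - 1), Φ (2 * Real.pi * (l : ℕ)) x = x := by
    intro a b hab hb h
    refine ⟨b - a, Finset.mem_Icc.2 ⟨by omega, by omega⟩, ?_⟩
    rw [Nat.cast_sub hab.le, mul_sub, sub_eq_neg_add, hΦ.add, ← h, hΦ.neg_apply]
  rcases lt_or_gt_of_ne hab with h | h
  · exact key a b h (Finset.mem_range.1 hb) heq
  · exact key b a h (Finset.mem_range.1 ha) heq.symm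

end PolyMap

/-! ### The flow is defined almost everywhere. -/

section NullSets

variable {ι : Type*} [Fintype ι] [DecidableEq ι] {j : ι}

/-- Level sets of `|∏_{k ∈ s} (z - a_k)|` are null sets. -/
theorem volume_norm_prod_sub_eq {ι : Type*} {s : Finset ι} (hs : s.Nonempty) (a : ι → ℂ) (r : ℝ) :
    volume {z : ℂ | ‖∏ k ∈ s, (z - a k)‖ = r} = 0 := by
  have hcl : IsClosed {z : ℂ | ‖∏ k ∈ s, (z - a k)‖ = r} :=
    isClosed_eq (continuous_finsetProd s fun k _ => by fun_prop).norm continuous_const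
  rw [← (Complex.volume_preserving_equiv_real_prod.symm).measure_preimage
    hcl.measurableSet.nullMeasurableSet, Measure.volume_eq_prod,
    Measure.measure_prod_null (Complex.measurableEquivRealProd.symm.measurable hcl.measurableSet)]
  refine Filter.Eventually.of_forall fun x => ?_
  -- On each vertical line the squared modulus is a polynomial in the imaginary part, of positive
  -- degree 2|s|, so it takes the value r² only finitely often; Fubini concludes.
  let R : Polynomial ℝ := ∏ k ∈ s,
    ((Polynomial.X - Polynomial.C (a k).im) ^ 2 + Polynomial.C ((x - (a k).re) ^ 2))
  have hmonic : ∀ k ∈ s, ((Polynomial.X - Polynomial.C (a k).im) ^ 2 +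
      Polynomial.C ((x - (a k).re) ^ 2)).Monic := fun k _ =>
    ((Polynomial.monic_X_sub_C _).pow 2).add_of_left
      (Polynomial.degree_C_le.trans_lt (by
        rw [Polynomial.degree_pow, Polynomial.degree_X_sub_C]; norm_num))
  have hdeg : R.natDegree = ∑ k ∈ s, 2 := by
    rw [Polynomial.natDegree_prod_of_monic _ _ hmonic]
    refine Finset.sum_congr rfl fun k _ => ?_
    rw [Polynomial.natDegree_add_C, Polynomial.natDegree_pow, Polynomial.natDegree_X_sub_C]
  have hne : R - Polynomial.C (r ^ 2) ≠ 0 := by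
    intro h
    have h2 := congrArg Polynomial.natDegree h
    rw [Polynomial.natDegree_sub_C, hdeg, Polynomial.natDegree_zero, Finset.sum_const,
      smul_eq_mul] at h2
    have := hs.card_pos
    omega
  have hfin : ((R - Polynomial.C (r ^ 2)).roots.toFinset : Set ℝ).Finite := Finset.finite_toSet _
  refine measure_mono_null (fun y hy => ?_) (hfin.measure_zero volume)
  have hy' : ‖∏ k ∈ s, ((⟨x, y⟩ : ℂ) - a k)‖ = r := hy
  simp only [Finset.mem_coe, Multiset.mem_toFinset]
  rw [Polynomial.mem_roots hne, Polynomial.IsRoot, Polynomial.eval_sub, Polynomial.eval_C,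
    Polynomial.eval_prod, ← hy', sub_eq_zero, ← Complex.normSq_eq_norm_sq, map_prod]
  refine Finset.prod_congr rfl fun k _ => ?_
  simp only [Polynomial.eval_add, Polynomial.eval_pow, Polynomial.eval_sub, Polynomial.eval_X,
    Polynomial.eval_C, Complex.normSq_apply, Complex.sub_re, Complex.sub_im]
  ring

theorem volume_eq_zero_of_forall_update {A : Set (ι → ℂ)} (hA : MeasurableSet A) (j : ι)
    (h : ∀ x, volume {z : ℂ | Function.update x j z ∈ A} = 0) : volume A = 0 := by
  have hm : Measurable (A.indicator (1 : (ι → ℂ) → ENNReal)) := measurable_one.indicator hA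
  rw [← lintegral_indicator_one hA, volume_pi,
    lintegral_eq_lmarginal_univ (f := A.indicator 1) (0 : ι → ℂ),
    ← Finset.insert_erase (Finset.mem_univ j),
    lmarginal_insert' _ hm (Finset.notMem_erase j _)]
  have h0 : (fun x : ι → ℂ => ∫⁻ z : ℂ, A.indicator (1 : (ι → ℂ) → ENNReal)
      (Function.update x j z)) = fun _ => 0 := by
    ext x
    have hset : MeasurableSet {z : ℂ | Function.update x j z ∈ A} :=
      (measurable_update x) hA
    rw [← h x, ← lintegral_indicator_one hset]
    rfl
  rw [h0]
  simp [lmarginal]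

theorem volume_apply_eq_apply {k l : ι} (hkl : k ≠ l) : volume {x : ι → ℂ | x k = x l} = 0 := by
  let f : (ι → ℂ) →ₗ[ℝ] ℂ := 
    LinearMap.proj (R := ℝ) (φ := fun _ : ι => ℂ) k - LinearMap.proj (R := ℝ) (φ := fun _ : ι => ℂ) l
  have h1 : {x : ι → ℂ | x k = x l} = (LinearMap.ker f : Set (ι → ℂ)) := by
    ext x
    simp [f, sub_eq_zero]
  rw [h1]
  refine Measure.addHaar_submodule _ _ fun h => ?_
  have h2 : (Pi.single k 1 : ι → ℂ) ∈ LinearMap.ker f := h ▸ Submodule.mem_top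
  simp [f, hkl.symm] at h2

/-- With the other coordinates fixed, P has finitely many critical points c, and a bad x_j satisfies
P = 0 or |P(x_j)| = |P(c)|: finitely many null level sets. Coincidences among coordinates lie in
finitely many proper subspaces. -/
theorem volume_compl_regularSet [Nontrivial ι] : volume (regularSet j)ᶜ = 0 := by
  have hcl : IsClosed {q : Circle × (ι → ℂ) | rotAt j q.1 q.2 ∈ polyMap j '' critSet j} :=
    ((isProperMap_polyMap j).isClosedMap _ (isClosed_critSet j)).preimage ((continuous_rotAt j).comp
      (f := fun q : Circle × (ι → ℂ) => ((q.1 : ℂ), q.2)) (by fun_prop))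
  have hsnd := isClosedMap_snd_of_compactSpace (X := Circle) (Y := ι → ℂ) _ hcl
  have hcont := (contDiff_polyMap j).continuous
  set A : Set (ι → ℂ) := {x | polyMap j x j = 0} ∪
    polyMap j ⁻¹' (Prod.snd '' {q : Circle × (ι → ℂ) | rotAt j q.1 q.2 ∈ polyMap j '' critSet j})
    with hAdef
  have hA : IsClosed A := (isClosed_eq ((continuous_apply j).comp hcont) continuous_const).union
    (hsnd.preimage hcont)
  have hne : (Finset.univ.erase j).Nonempty := by
    obtain ⟨k, hk⟩ := exists_ne j
    exact ⟨k, by simp [hk]⟩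
  have hA0 : volume A = 0 := by
    refine volume_eq_zero_of_forall_update hA.measurableSet j fun x => ?_
    have hder : (nodePoly j x).derivative ≠ 0 := by
      intro h
      have h2 := Polynomial.derivative_eq_zero.1 h
      rw [natDegree_nodePoly] at h2
      have := Fintype.one_lt_card (α := ι)
      omega
    have hsub : {z : ℂ | Function.update x j z ∈ A} ⊆
        {z : ℂ | ‖∏ k ∈ Finset.univ.erase j, (z - x k)‖ = 0} ∪
        ⋃ c ∈ (nodePoly j x).derivative.roots.toFinset,
          {z : ℂ | ‖∏ k ∈ Finset.univ.erase j, (z - x k)‖ = ‖(nodePoly j x).eval c‖} := by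
      rintro z (hz | ⟨⟨w, y⟩, ⟨x', hx', hw⟩, hy⟩)
      · left
        rw [mem_ofPred_eq, polyMap_update, Function.update_self, eval_nodePoly] at hz
        rw [mem_ofPred_eq, hz, norm_zero]
      · right
        simp only at hy hw
        rw [polyMap_update] at hy
        have hxx : ∀ k, k ≠ j → x' k = x k := fun k hk => by
          rw [← polyMap_of_ne j x' hk, hw, hy]
          simp [rotAt, hk]
        have hnode : nodePoly j x' = nodePoly j x := nodePoly_congr j hxx
        rw [critSet, mem_ofPred_eq, hnode] at hx'
        refine mem_iUnion₂.2 ⟨x' j, ?_, ?_⟩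
        · rw [Multiset.mem_toFinset, Polynomial.mem_roots hder]
          exact hx'
        · have h3 := congrFun hw j
          rw [polyMap_self, ← eval_nodePoly, hnode, hy] at h3
          rw [mem_ofPred_eq, h3, ← eval_nodePoly]
          simp [rotAt, Circle.norm_coe]
    refine measure_mono_null hsub (measure_union_null (volume_norm_prod_sub_eq hne x 0) ?_)
    refine (measure_biUnion_null_iff (Finset.countable_toSet _)).2 ?_
    exact fun c _ => volume_norm_prod_sub_eq hne x _
  have hN : volume (⋃ k : ι, ⋃ l : ι, ⋃ _ : k ≠ l, {x : ι → ℂ | x k = x l}) = 0 := by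
    simp only [measure_iUnion_null_iff]
    exact fun k l hkl => volume_apply_eq_apply hkl
  refine measure_mono_null (fun x hx => ?_) (measure_union_null hA0 hN)
  by_contra hcon
  rw [mem_union, not_or] at hcon
  refine hx ⟨⟨fun h => hcon.1 (Or.inl h), fun k l hk hl hkl h => hcon.2 ?_⟩,
    fun w hw => hcon.1 (Or.inr ⟨(w, polyMap j x), hw, rfl⟩)⟩
  rw [polyMap_of_ne _ _ hk, polyMap_of_ne _ _ hl] at h
  exact mem_iUnion.2 ⟨k, mem_iUnion.2 ⟨l, mem_iUnion.2 ⟨hkl, h⟩⟩⟩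

end NullSets

/-! ### The triangle identity and the lower bound for the field strengths. -/

theorem re_inv_mul_conj_inv (p q : ℂ) :
    (p⁻¹ * (starRingEnd ℂ) q⁻¹).re = (p.re * q.re + p.im * q.im) / (normSq p * normSq q) := by
  simp only [map_inv₀, Complex.mul_re, Complex.inv_re, Complex.inv_im, conj_re, conj_im, normSq_conj]
  rw [div_mul_div_comm, div_mul_div_comm, ← sub_div]
  congr 1
  ring

/-- The cyclic sum over the vertices of a triangle is nonnegative. -/
theorem cyclic_sum_nonneg {a b c : ℂ} (hab : a ≠ b) (hbc : b ≠ c) (hca : c ≠ a) :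
    0 ≤ ((a - b)⁻¹ * (starRingEnd ℂ) (a - c)⁻¹).re + ((b - c)⁻¹ * (starRingEnd ℂ) (b - a)⁻¹).re +
      ((c - a)⁻¹ * (starRingEnd ℂ) (c - b)⁻¹).re := by
  simp only [re_inv_mul_conj_inv]
  have e1 : normSq (b - a) = normSq (a - b) := by rw [← normSq_neg, neg_sub]
  have e2 : normSq (c - b) = normSq (b - c) := by rw [← normSq_neg, neg_sub]
  have e3 : normSq (a - c) = normSq (c - a) := by rw [← normSq_neg, neg_sub]
  rw [e1, e2, e3]
  have h1 := normSq_pos.2 (sub_ne_zero.2 hab)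
  have h2 := normSq_pos.2 (sub_ne_zero.2 hbc)
  have h3 := normSq_pos.2 (sub_ne_zero.2 hca)
  set A := normSq (a - b) with hA
  set B := normSq (b - c) with hB
  set C := normSq (c - a) with hC
  have key : ∀ P Q S : ℝ, P / (A * C) + Q / (B * A) + S / (C * B) =
      (P * B + Q * C + S * A) / (A * B * C) := fun P Q S => by field_simp
  rw [key]
  refine div_nonneg ?_ (by positivity)
  simp only [hA, hB, hC, normSq_apply, Complex.sub_re, Complex.sub_im]
  -- The numerator is twice the square of the cross product of two edges, that is, eight times the
  -- squared area of the triangle.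
  have := sq_nonneg ((a.re - b.re) * (b.im - c.im) - (a.im - b.im) * (b.re - c.re))
  nlinarith [this]

/-- The squares of the field strengths dominate the sum over pairs. -/
theorem sum_normSq_inv_le {ι : Type*} [Fintype ι] {z : ι → ℂ}
    (hz : Function.Injective z) :
    ∑ j, ∑ k, normSq (z j - z k)⁻¹ ≤ ∑ j, normSq (∑ k, (z j - z k)⁻¹) := by
  classical
  let c : ι → ι → ι → ℝ := fun j k l =>
    if k = l then 0 else ((z j - z k)⁻¹ * (starRingEnd ℂ) (z j - z l)⁻¹).re
  have h1 : ∀ j, normSq (∑ k, (z j - z k)⁻¹) =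
      ∑ k, normSq (z j - z k)⁻¹ + ∑ k, ∑ l, c j k l := by
    intro j
    have h2 : normSq (∑ k, (z j - z k)⁻¹) =
        ∑ k, ∑ l, ((z j - z k)⁻¹ * (starRingEnd ℂ) (z j - z l)⁻¹).re := by
      rw [← ofReal_re (normSq _), ← mul_conj, map_sum, Finset.sum_mul_sum, re_sum]
      simp only [re_sum]
    rw [h2, ← Finset.sum_add_distrib]
    refine Finset.sum_congr rfl fun k _ => ?_
    rw [← Finset.add_sum_erase _ _ (Finset.mem_univ k), mul_conj, ofReal_re]
    congr 1
    rw [← Finset.add_sum_erase Finset.univ (c j k) (Finset.mem_univ k)]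
    simp only [c, if_true, zero_add]
    refine Finset.sum_congr rfl fun l hl => ?_
    rw [if_neg (Finset.ne_of_mem_erase hl).symm]
  -- If two of the indices coincide, all three terms vanish, by the definition of `c` or because 0⁻¹
  -- = 0.
  have hcyc : ∀ j k l, 0 ≤ c j k l + c k l j + c l j k := by
    intro j k l
    by_cases hkl : k = l
    · subst hkl
      simp [c]
    · by_cases hlj : l = j
      · subst hlj
        simp [c]
      · by_cases hjk : j = k
        · subst hjk
          simp [c]
        · simp only [c, if_neg hkl, if_neg hlj, if_neg hjk]
          exact cyclic_sum_nonneg (hz.ne hjk) (hz.ne hkl) (hz.ne hlj)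
  have hs1 : ∑ j, ∑ k, ∑ l, c k l j = ∑ j, ∑ k, ∑ l, c j k l := by
    rw [Finset.sum_comm]
    exact Finset.sum_congr rfl fun k _ => Finset.sum_comm
  have hs2 : ∑ j, ∑ k, ∑ l, c l j k = ∑ j, ∑ k, ∑ l, c j k l := by
    have : ∀ j, ∑ k, ∑ l, c l j k = ∑ l, ∑ k, c l j k := fun j => Finset.sum_comm
    simp only [this]
    rw [Finset.sum_comm]
  -- Summed over all triples, the three cyclic rotations contribute equally, so this is three times
  -- the total of the cross terms.
  have hsum : 0 ≤ ∑ j, ∑ k, ∑ l, (c j k l + c k l j + c l j k) :=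
    Finset.sum_nonneg fun j _ => Finset.sum_nonneg fun k _ => Finset.sum_nonneg fun l _ =>
      hcyc j k l
  simp only [Finset.sum_add_distrib] at hsum
  rw [hs1, hs2] at hsum
  simp only [h1, Finset.sum_add_distrib]
  linarith

/-! ### Transfer to planar configurations; the vector potential as a direction field. -/

/-- Transport of a flow along a linear isomorphism. -/
theorem IsFlowOn.conj {V W : Type*} [NormedAddCommGroup V] [NormedSpace ℝ V]
    [NormedAddCommGroup W] [NormedSpace ℝ W] {Φ : ℝ → W → W} {X : W → W} {E : Set W}
    (hΦ : IsFlowOn Φ X E) (T : V ≃L[ℝ] W) :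
    IsFlowOn (fun t x => T.symm (Φ t (T x))) (fun x => T.symm (X (T x))) (T ⁻¹' E) where
  mapsTo t x hx := by simpa using hΦ.mapsTo t _ hx
  eq_self t x hx := by simp [hΦ.eq_self t (T x) hx]
  zero x := by simp [hΦ.zero]
  add s t x := by simp [hΦ.add]
  continuousOn := T.symm.continuous.comp_continuousOn (hΦ.continuousOn.comp
    (f := fun q : ℝ × V => (q.1, T q.2)) (by fun_prop) fun q hq => ⟨mem_univ _, hq.2⟩)
  contDiffOn t := T.symm.contDiff.comp_contDiffOn
    ((hΦ.contDiffOn t).comp T.contDiff.contDiffOn fun x hx => hx)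
  hasDerivAt t x hx := by
    have := T.symm.hasFDerivAt.comp_hasDerivAt t (hΦ.hasDerivAt t (T x) hx)
    simpa [Function.comp_def] using this

/-- Planar configurations in complex notation. -/
def toComplex (N : ℕ) : Config N ≃L[ℝ] (Fin N → ℂ) :=
  ContinuousLinearEquiv.piCongrRight fun _ =>
    Complex.orthonormalBasisOneI.repr.symm.toContinuousLinearEquiv

variable {N : ℕ}

theorem toComplex_apply (x : Config N) (k : Fin N) :
    toComplex N x k = x k 0 + x k 1 * I := by
  rw [← Complex.orthonormalBasisOneI_repr_symm_apply]
  rfl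

theorem toComplex_re (x : Config N) (k : Fin N) : (toComplex N x k).re = x k 0 := by
  simp [toComplex_apply]

theorem toComplex_im (x : Config N) (k : Fin N) : (toComplex N x k).im = x k 1 := by
  simp [toComplex_apply]

theorem toComplex_symm_single (j : Fin N) (c : ℂ) :
    (toComplex N).symm (Pi.single j c) = c.re • coordDir j 0 + c.im • coordDir j 1 := by
  rw [ContinuousLinearEquiv.symm_apply_eq]
  ext k
  rw [toComplex_apply]
  by_cases hk : k = j
  · subst hk
    simp [coordDir, Complex.re_add_im]
  · simp [coordDir, hk]

theorem toComplex_coordDir_zero (j : Fin N) : toComplex N (coordDir j 0) = Pi.single j 1 := by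
  rw [← ContinuousLinearEquiv.eq_symm_apply, toComplex_symm_single]
  simp

theorem toComplex_coordDir_one (j : Fin N) : toComplex N (coordDir j 1) = Pi.single j I := by
  rw [← ContinuousLinearEquiv.eq_symm_apply, toComplex_symm_single]
  simp

theorem measurePreserving_toComplex : MeasurePreserving (toComplex N) volume volume :=
  volume_preserving_pi fun _ => Complex.orthonormalBasisOneI.repr.symm.measurePreserving

theorem norm_toComplex_sub (x : Config N) (j k : Fin N) :
    ‖toComplex N x j - toComplex N x k‖ = dist (x j) (x k) := by
  rw [dist_eq_norm, ← Complex.orthonormalBasisOneI.repr.symm.norm_map, map_sub]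
  rfl

/-- The sum `∑_{k ≠ j} 1 / (z_j - z_k)`, in complex notation. -/
def fieldSum (j : Fin N) (x : Config N) : ℂ :=
  ∑ k ∈ Finset.univ.erase j, (toComplex N x j - toComplex N x k)⁻¹

/-- The components of the vector potential of unit flux. -/
def unitField (j : Fin N) (m : Fin 2) (x : Config N) : ℝ := ![(fieldSum j x).im, (fieldSum j x).re] m

theorem unitField_zero (j : Fin N) (x : Config N) : unitField j 0 x = (fieldSum j x).im := rfl

theorem unitField_one (j : Fin N) (x : Config N) : unitField j 1 x = (fieldSum j x).re := rfl

/-- Because 1/(a + ib) = (a - ib)/(a² + b²), the potential in complex notation is α i times the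
conjugate of the field sum S_j. -/
theorem potential_eq (α : ℝ) (x : Config N) (j : Fin N) (m : Fin 2) :
    potential α x j m = α * unitField j m x := by
  have h : ∀ k, dist (x j) (x k) ^ 2 = normSq (toComplex N x j - toComplex N x k) := fun k => by
    rw [normSq_eq_norm_sq, norm_toComplex_sub]
  fin_cases m
  · change potential α x j 0 = α * unitField j 0 x
    simp [potential, unitField_zero, fieldSum, im_sum, toComplex_im, h, Complex.inv_im]
    rw [← mul_neg, ← Finset.sum_neg_distrib]
    congr 1
    refine Finset.sum_congr rfl fun k _ => ?_
    ring
  · change potential α x j 1 = α * unitField j 1 x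
    simp [potential, unitField_one, fieldSum, re_sum, toComplex_re, h, Complex.inv_re]

theorem measurable_fieldSum (j : Fin N) : Measurable (fieldSum j) := by
  unfold fieldSum
  refine Finset.measurable_sum _ fun k _ => Measurable.inv ?_
  have : Continuous fun x : Config N => toComplex N x j - toComplex N x k :=
    ((continuous_apply j).comp (toComplex N).continuous).sub
      ((continuous_apply k).comp (toComplex N).continuous)
  exact this.measurable

theorem measurable_unitField (j : Fin N) (m : Fin 2) : Measurable (unitField j m) := by
  fin_cases m
  · exact measurable_im.comp (measurable_fieldSum j)
  · exact measurable_re.comp (measurable_fieldSum j)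

/-- The configurations for which the rotation flow of particle `j` is defined. -/
def flowDomain (j : Fin N) : Set (Config N) := toComplex N ⁻¹' regularSet j

theorem isOpen_flowDomain (hN : 2 ≤ N) (j : Fin N) : IsOpen (flowDomain j) := by
  have : Nontrivial (Fin N) := Fin.nontrivial_iff_two_le.2 hN
  exact isOpen_regularSet.preimage (toComplex N).continuous

theorem flowDomain_subset (j : Fin N) : flowDomain j ⊆ collisionFree N := by
  intro x hx k l hkl
  refine injective_of_mem_regularSet hx ?_
  rw [toComplex_apply, toComplex_apply, hkl]

theorem volume_compl_flowDomain (hN : 2 ≤ N) (j : Fin N) : volume (flowDomain j)ᶜ = 0 := by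
  have : Nontrivial (Fin N) := Fin.nontrivial_iff_two_le.2 hN
  rw [flowDomain, ← preimage_compl, measurePreserving_toComplex.measure_preimage
    isOpen_regularSet.isClosed_compl.measurableSet.nullMeasurableSet]
  exact volume_compl_regularSet

theorem fieldSum_ne_zero {j : Fin N} {x : Config N} (hx : x ∈ flowDomain j) : fieldSum j x ≠ 0 :=
  sum_inv_ne_zero hx

/-- The direction field of the flow on configurations. -/
def flowField (j : Fin N) (x : Config N) : Config N :=
  (toComplex N).symm (rotField j (toComplex N x))

/-- Since i/S = i S̄/|S|², the flow runs along the vector potential of unit flux, divided by its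
squared length. -/
theorem flowField_eq (j : Fin N) (x : Config N) :
    flowField j x = (unitField j 0 x / normSq (fieldSum j x)) • coordDir j 0 +
      (unitField j 1 x / normSq (fieldSum j x)) • coordDir j 1 := by
  rw [flowField, rotField, toComplex_symm_single]
  change (I / fieldSum j x).re • coordDir j 0 + (I / fieldSum j x).im • coordDir j 1 = _
  simp [Complex.div_re, Complex.div_im, unitField_zero, unitField_one]

theorem contDiffAt_sum_inv {j : Fin N} {z : Fin N → ℂ} (hz : z ∈ regularSet j) :
    ContDiffAt ℂ ∞ (fun z : Fin N → ℂ => ∑ k ∈ Finset.univ.erase j, (z j - z k)⁻¹) z := by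
  refine ContDiffAt.sum fun k hk => ContDiffAt.inv ?_
    (ne_of_mem_regularSet hz (Finset.ne_of_mem_erase hk))
  fun_prop

theorem contDiffAt_fieldSum {j : Fin N} {x : Config N} (hx : x ∈ flowDomain j) :
    ContDiffAt ℝ ∞ (fieldSum j) x :=
  ((contDiffAt_sum_inv hx).restrict_scalars ℝ).comp x (toComplex N).contDiff.contDiffAt

theorem contDiffAt_unitField {j : Fin N} {x : Config N} (hx : x ∈ flowDomain j) (m : Fin 2) :
    ContDiffAt ℝ ∞ (unitField j m) x := by
  fin_cases m
  · exact imCLM.contDiff.contDiffAt.comp x (contDiffAt_fieldSum hx)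
  · exact reCLM.contDiff.contDiffAt.comp x (contDiffAt_fieldSum hx)

theorem continuousOn_flowField (hN : 2 ≤ N) (j : Fin N) :
    ContinuousOn (flowField j) (flowDomain j) := by
  have : Nontrivial (Fin N) := Fin.nontrivial_iff_two_le.2 hN
  exact (toComplex N).symm.continuous.comp_continuousOn
    (continuousOn_rotField.comp (toComplex N).continuous.continuousOn fun x hx => hx)

/-- The vector potential is divergence free. -/
theorem div_unitField {j : Fin N} {x : Config N} (hx : x ∈ flowDomain j) :
    fderiv ℝ (unitField j 0) x (coordDir j 0) + fderiv ℝ (unitField j 1) x (coordDir j 1) = 0 := by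
  obtain ⟨D, hD⟩ : ∃ D, HasFDerivAt (𝕜 := ℂ)
      (fun z : Fin N → ℂ => ∑ k ∈ Finset.univ.erase j, (z j - z k)⁻¹) D (toComplex N x) :=
    ⟨_, ((contDiffAt_sum_inv hx).differentiableAt (by simp)).hasFDerivAt⟩
  have h1 : HasFDerivAt (fieldSum j)
      ((D.restrictScalars ℝ).comp (toComplex N : Config N →L[ℝ] (Fin N → ℂ))) x :=
    (hD.restrictScalars ℝ).comp x (toComplex N).hasFDerivAt
  have h2 : HasFDerivAt (unitField j 0) (imCLM.comp ((D.restrictScalars ℝ).comp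
      (toComplex N : Config N →L[ℝ] (Fin N → ℂ)))) x := imCLM.hasFDerivAt.comp x h1
  have h3 : HasFDerivAt (unitField j 1) (reCLM.comp ((D.restrictScalars ℝ).comp
      (toComplex N : Config N →L[ℝ] (Fin N → ℂ)))) x := reCLM.hasFDerivAt.comp x h1
  -- Complex linearity of the differential of S_j is the Cauchy-Riemann equation, which cancels the
  -- two partial derivatives.
  have h4 : D (Pi.single j I) = I * D (Pi.single j 1) := by
    rw [← smul_eq_mul, ← map_smul, ← Pi.single_smul, smul_eq_mul, mul_one]
  rw [h2.fderiv, h3.fderiv]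
  simp [toComplex_coordDir_zero, toComplex_coordDir_one, h4]

theorem isTestOn_unitField_mul {j : Fin N} (m : Fin 2) {φ : Config N → ℝ}
    (hφ : IsTestOn φ (flowDomain j)) : IsTestOn (fun x => unitField j m x * φ x) (flowDomain j) := by
  have hsub : tsupport (fun x => unitField j m x * φ x) ⊆ tsupport φ :=
    closure_mono (Function.support_mul_subset_right _ _)
  exact ⟨contDiff_of_contDiffAt_tsupport fun x hx =>
      (contDiffAt_unitField (hφ.tsupport_subset (hsub hx)) m).mul hφ.contDiff.contDiffAt,
    hφ.hasCompactSupport.of_isClosed_subset (isClosed_tsupport _) hsub,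
    hsub.trans hφ.tsupport_subset⟩

/-- Writing b for the unit potential, div(φ b) = b · ∇φ because div b = 0, and b = |S_j|² X. The
weight |S_j|² thus turns the derivative along the flow into a divergence. -/
theorem sum_fderiv_unitField_mul {j : Fin N} {φ : Config N → ℝ}
    (hφ : IsTestOn φ (flowDomain j)) (x : Config N) :
    ∑ m, fderiv ℝ (fun x => unitField j m x * φ x) x (coordDir j m) =
      normSq (fieldSum j x) * fderiv ℝ φ x (flowField j x) := by
  by_cases hx : x ∈ tsupport φ
  · have hxE := hφ.tsupport_subset hx
    have h1 : ∀ m, fderiv ℝ (fun x => unitField j m x * φ x) x (coordDir j m) =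
        unitField j m x * fderiv ℝ φ x (coordDir j m) +
          φ x * fderiv ℝ (unitField j m) x (coordDir j m) := by
      intro m
      have := fderiv_fun_mul ((contDiffAt_unitField hxE m).differentiableAt (by simp))
        (hφ.contDiff.differentiable (by simp) x)
      rw [this]
      rfl
    have h2 := normSq_pos.2 (fieldSum_ne_zero hxE)
    rw [Fin.sum_univ_two, h1, h1, flowField_eq, map_add, map_smul, map_smul, smul_eq_mul,
      smul_eq_mul]
    field_simp
    linear_combination φ x * div_unitField hxE
  · have h0 : ∀ ψ : Config N → ℝ, tsupport ψ ⊆ tsupport φ → fderiv ℝ ψ x = 0 := fun ψ hψ =>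
      image_eq_zero_of_notMem_tsupport fun h => hx (hψ (tsupport_fderiv_subset ℝ h))
    rw [h0 φ subset_rfl]
    have h1 : ∀ m, fderiv ℝ (fun x => unitField j m x * φ x) x = 0 := fun m =>
      h0 _ (closure_mono (Function.support_mul_subset_right _ _))
    simp [h1]

theorem IsLocallyL2On.mono {f : Config N → ℂ} {Ω Ω' : Set (Config N)} (h : IsLocallyL2On f Ω)
    (hΩ : Ω' ⊆ Ω) : IsLocallyL2On f Ω' := fun K hK hKΩ => h K hK (hKΩ.trans hΩ)

theorem IsWeakDerivOn.mono {u g : Config N → ℂ} {v : Config N} {Ω Ω' : Set (Config N)}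
    (h : IsWeakDerivOn u g v Ω) (hΩ : Ω' ⊆ Ω) : IsWeakDerivOn u g v Ω' :=
  fun φ h1 h2 h3 => h φ h1 h2 (h3.trans hΩ)

/-- The constant of the Hardy inequality bounds the distance of `-α` to the frequencies `m / l`. -/
theorem hardyConst_le (hN : 2 ≤ N) (α : ℝ) {l : ℕ} (hl : l ∈ Finset.Icc 1 (N - 1)) (m : ℤ) :
    hardyConst N hN α ≤ (α + m / l) ^ 2 := by
  have hl0 : (0 : ℝ) < l := by exact_mod_cast (Finset.mem_Icc.1 hl).1
  refine (Finset.inf'_le _ hl).trans ?_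
  have h1 : ⨅ k : ℤ, |(k : ℝ) - (l : ℝ) * α| ≤ |((-m : ℤ) : ℝ) - (l : ℝ) * α| :=
    ciInf_le ⟨0, by rintro _ ⟨k, rfl⟩; exact abs_nonneg _⟩ _
  have h0 : 0 ≤ ⨅ k : ℤ, |(k : ℝ) - (l : ℝ) * α| := Real.iInf_nonneg fun k => abs_nonneg _
  calc ((⨅ k : ℤ, |(k : ℝ) - (l : ℝ) * α|) / (l : ℝ)) ^ 2
      ≤ (|((-m : ℤ) : ℝ) - (l : ℝ) * α| / l) ^ 2 := by gcongr
    _ = (α + m / l) ^ 2 := by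
      rw [div_pow, sq_abs, eq_comm, eq_div_iff (by positivity), ← mul_pow]
      push_cast
      have : (α + m / l) * l = -(-(m : ℝ) - l * α) := by field_simp; ring
      rw [this, neg_sq]

/-- The periodic flow on configurations, with its arithmetic. -/
theorem exists_configFlow (hN : 2 ≤ N) (j : Fin N) (α : ℝ) :
    ∃ (Φ : ℝ → Config N → Config N) (L : ℝ), 0 < L ∧
      IsFlowOn Φ (flowField j) (flowDomain j) ∧ (∀ x, Φ L x = x) ∧
      ∀ x ∈ flowDomain j, ∀ n : ℤ,
        (∃ p : ℝ, Φ p x = x ∧ exp (-(2 * Real.pi * I * n * p / L)) ≠ 1) ∨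
        hardyConst N hN α ≤ (α + 2 * Real.pi * n / L) ^ 2 := by
  have : Nontrivial (Fin N) := Fin.nontrivial_iff_two_le.2 hN
  obtain ⟨Φ₀, hΦ₀, hpoly⟩ := exists_rotFlow j
  have hΦ := hΦ₀.conj (toComplex N)
  set Φ : ℝ → Config N → Config N := fun t x => (toComplex N).symm (Φ₀ t (toComplex N x)) with hΦdef
  have hper : ∀ x ∈ flowDomain j, ∃ l ∈ Finset.Icc 1 (N - 1),
      Φ (2 * Real.pi * (l : ℕ)) x = x := by
    intro x hx
    obtain ⟨l, hl, h⟩ := exists_period hΦ₀ hpoly hx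
    rw [Fintype.card_fin] at hl
    exact ⟨l, hl, by simp [hΦdef, h]⟩
  have hfac : (0 : ℝ) < (N - 1).factorial := by exact_mod_cast Nat.factorial_pos _
  have hpi := Real.pi_pos
  -- (N - 1)! is a multiple of every admissible l, so this is a common period of all orbits, even
  -- though l varies from orbit to orbit.
  refine ⟨Φ, 2 * Real.pi * (N - 1).factorial, by positivity, hΦ, fun x => ?_, fun x hx n => ?_⟩
  · by_cases hx : x ∈ flowDomain j
    · obtain ⟨l, hl, h⟩ := hper x hx
      obtain ⟨q, hq⟩ := Nat.dvd_factorial (Finset.mem_Icc.1 hl).1 (Finset.mem_Icc.1 hl).2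
      have hit : ∀ q : ℕ, Φ (2 * Real.pi * (l * q : ℕ)) x = x := by
        intro q
        induction q with
        | zero => simpa using hΦ.zero x
        | succ q ih =>
          have : 2 * Real.pi * ((l * (q + 1) : ℕ) : ℝ) =
              2 * Real.pi * (l * q : ℕ) + 2 * Real.pi * l := by
            push_cast
            ring
          rw [this, hΦ.add, h, ih]
      rw [hq]
      exact hit q
    · exact hΦ.eq_self _ x hx
  · obtain ⟨l, hl, h⟩ := hper x hx
    have hl0 : (0 : ℝ) < l := by exact_mod_cast (Finset.mem_Icc.1 hl).1
    -- The `n`-th character has frequency n/(N - 1)!. It has period 2πl exactly when n l/(N - 1)! is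
    -- an integer, and then the frequency is a fraction with denominator l.
    by_cases hexp : exp (-(2 * Real.pi * I * n * ((2 * Real.pi * l : ℝ) : ℂ) /
        ((2 * Real.pi * (N - 1).factorial : ℝ) : ℂ))) = 1
    · right
      obtain ⟨m, hm⟩ := Complex.exp_eq_one_iff.1 hexp
      have h1 : (n : ℝ) * l / (N - 1).factorial = ((-m : ℤ) : ℝ) := by
        have hpi' : (Real.pi : ℂ) ≠ 0 := by exact_mod_cast hpi.ne'
        have hfac' : ((N - 1).factorial : ℂ) ≠ 0 := by exact_mod_cast hfac.ne'
        have h2 : (n : ℂ) * l / (N - 1).factorial = ((-m : ℤ) : ℂ) := by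
          have h3 : (2 * Real.pi * I : ℂ) ≠ 0 := by simp [hpi']
          apply mul_left_cancel₀ h3
          push_cast at hm ⊢
          rw [mul_neg, mul_comm _ (m : ℂ), ← hm]
          field_simp
        exact_mod_cast h2
      have h4 : 2 * Real.pi * n / (2 * Real.pi * (N - 1).factorial) = ((-m : ℤ) : ℝ) / l := by
        rw [← h1]
        field_simp
      rw [h4]
      exact hardyConst_le hN α hl (-m)
    · exact Or.inl ⟨_, h, hexp⟩

/-! ### The invariant measure and the inequality for one particle. -/

/-- The weighted measure invariant under the flow. -/
def flowMeasure (j : Fin N) : Measure (Config N) :=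
  (volume.restrict (flowDomain j)).withDensity fun x => ENNReal.ofReal (normSq (fieldSum j x))

instance (j : Fin N) : SFinite (flowMeasure j) := by unfold flowMeasure; infer_instance

theorem measurable_density (j : Fin N) :
    Measurable fun x : Config N => ENNReal.ofReal (normSq (fieldSum j x)) :=
  (continuous_normSq.measurable.comp (measurable_fieldSum j)).ennreal_ofReal

theorem continuousOn_fieldSum (j : Fin N) : ContinuousOn (fieldSum j) (flowDomain j) :=
  fun _ hx => (contDiffAt_fieldSum hx).continuousAt.continuousWithinAt

theorem flowMeasure_compl (hN : 2 ≤ N) (j : Fin N) : flowMeasure j (flowDomain j)ᶜ = 0 := by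
  refine withDensity_absolutelyContinuous _ _ ?_
  rw [Measure.restrict_apply (isOpen_flowDomain hN j).isClosed_compl.measurableSet,
    compl_inter_self, measure_empty]

theorem exists_flowMeasure_restrict_le (j : Fin N) {K : Set (Config N)} (hK : IsCompact K)
    (hKE : K ⊆ flowDomain j) :
    ∃ C : ENNReal, C ≠ ⊤ ∧ (flowMeasure j).restrict K ≤ C • volume.restrict K := by
  obtain ⟨C, hC⟩ := hK.exists_bound_of_continuousOn
    (continuous_normSq.comp_continuousOn ((continuousOn_fieldSum j).mono hKE))
  refine ⟨ENNReal.ofReal C, ENNReal.ofReal_ne_top, ?_⟩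
  have hKm := hK.isClosed.measurableSet
  rw [flowMeasure, restrict_withDensity hKm, Measure.restrict_restrict hKm,
    inter_eq_left.2 hKE, ← withDensity_const]
  refine withDensity_mono ?_
  filter_upwards [ae_restrict_mem hKm] with x hx
  exact ENNReal.ofReal_le_ofReal ((le_abs_self _).trans (hC x hx))

theorem flowMeasure_lt_top (j : Fin N) (K : Set (Config N)) (hK : IsCompact K)
    (hKE : K ⊆ flowDomain j) : flowMeasure j K < ⊤ := by
  obtain ⟨C, hC, hle⟩ := exists_flowMeasure_restrict_le j hK hKE
  have := hle univ
  rw [Measure.restrict_apply_univ, Measure.smul_apply, Measure.restrict_apply_univ] at this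
  exact this.trans_lt (ENNReal.mul_lt_top hC.lt_top hK.measure_lt_top)

theorem memLp_flowMeasure {j : Fin N} {f : Config N → ℂ} (hf : IsLocallyL2On f (flowDomain j))
    (K : Set (Config N)) (hK : IsCompact K) (hKE : K ⊆ flowDomain j) :
    MemLp f 2 ((flowMeasure j).restrict K) := by
  obtain ⟨C, hC, hle⟩ := exists_flowMeasure_restrict_le j hK hKE
  exact (hf K hK hKE).of_measure_le_smul hC hle

theorem integral_flowMeasure {F : Type*} [NormedAddCommGroup F] [NormedSpace ℝ F]
    (hN : 2 ≤ N) (j : Fin N) (f : Config N → F) :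
    ∫ x, f x ∂flowMeasure j = ∫ x, normSq (fieldSum j x) • f x := by
  rw [flowMeasure, integral_withDensity_eq_integral_toReal_smul (measurable_density j)
    (Filter.Eventually.of_forall fun x => ENNReal.ofReal_lt_top)]
  simp only [ENNReal.toReal_ofReal (normSq_nonneg _)]
  rw [Measure.restrict_eq_self_of_ae_mem]
  rw [ae_iff]
  exact volume_compl_flowDomain hN j

theorem integrable_mul_of_locallyL2 {Ω : Set (Config N)} {f : Config N → ℂ}
    (hf : IsLocallyL2On f Ω) {χ : Config N → ℝ} (hχ : Continuous χ) (hχc : HasCompactSupport χ)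
    (hχΩ : tsupport χ ⊆ Ω) : Integrable fun x => f x * (χ x : ℂ) := by
  have : IsFiniteMeasure (volume.restrict (tsupport χ)) :=
    ⟨by rw [Measure.restrict_apply_univ]; exact hχc.measure_lt_top⟩
  have h1 : Integrable f (volume.restrict (tsupport χ)) :=
    (hf _ hχc hχΩ).integrable (by norm_num)
  have h2 : IntegrableOn (fun x => f x * (χ x : ℂ)) (tsupport χ) :=
    IntegrableOn.mul_continuousOn h1 (continuous_ofReal.comp hχ).continuousOn hχc
  rwa [integrableOn_iff_integrable_of_support_subset] at h2
  intro x hx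
  by_contra hxs
  exact hx (by simp [image_eq_zero_of_notMem_tsupport hxs])

/-- The weak derivative of `u` in the direction of the flow. -/
def flowDeriv (j : Fin N) (g : Fin 2 → Config N → ℂ) (x : Config N) : ℂ :=
  ∑ m, ((unitField j m x / normSq (fieldSum j x) : ℝ) : ℂ) * g m x

theorem normSq_mul_flowDeriv {j : Fin N} (g : Fin 2 → Config N → ℂ) {x : Config N}
    (hx : x ∈ flowDomain j) :
    (normSq (fieldSum j x) : ℂ) * flowDeriv j g x = ∑ m, g m x * (unitField j m x : ℂ) := by
  have h : (normSq (fieldSum j x) : ℂ) ≠ 0 := by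
    exact_mod_cast (normSq_pos.2 (fieldSum_ne_zero hx)).ne'
  rw [flowDeriv, Finset.mul_sum]
  refine Finset.sum_congr rfl fun m _ => ?_
  push_cast
  field_simp

/-- Test the weak partial derivative in direction `m` with φ times the `m`-th component of the unit
potential, and sum over `m`; by `sum_fderiv_unitField_mul` only the derivative of φ along the flow
remains. -/
theorem integral_flowDeriv (hN : 2 ≤ N) {j : Fin N} {u : Config N → ℂ} {g : Fin 2 → Config N → ℂ}
    (hu : IsLocallyL2On u (flowDomain j)) (hg : ∀ m, IsLocallyL2On (g m) (flowDomain j))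
    (hw : ∀ m, IsWeakDerivOn u (g m) (coordDir j m) (flowDomain j))
    {φ : Config N → ℝ} (hφ : IsTestOn φ (flowDomain j)) :
    ∫ x, u x * (fderiv ℝ φ x (flowField j x) : ℂ) ∂flowMeasure j =
      -∫ x, flowDeriv j g x * (φ x : ℂ) ∂flowMeasure j := by
  rw [integral_flowMeasure hN, integral_flowMeasure hN]
  have hψ := fun m => isTestOn_unitField_mul m hφ
  have hfd : ∀ m, Integrable fun x => u x *
      (fderiv ℝ (fun x => unitField j m x * φ x) x (coordDir j m) : ℂ) := by
    intro m
    have hsub := IsTestOn.tsupport_fderiv_apply (φ := fun x => unitField j m x * φ x)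
      (X := fun _ => coordDir j m)
    exact integrable_mul_of_locallyL2 hu
      (((hψ m).contDiff.continuous_fderiv (by simp)).clm_apply continuous_const)
      ((hψ m).hasCompactSupport.of_isClosed_subset (isClosed_tsupport _) hsub)
      (hsub.trans (hψ m).tsupport_subset)
  have hgd : ∀ m, Integrable fun x => g m x * ((unitField j m x * φ x : ℝ) : ℂ) := fun m =>
    integrable_mul_of_locallyL2 (hg m) (hψ m).contDiff.continuous (hψ m).hasCompactSupport
      (hψ m).tsupport_subset
  have h1 : ∀ x, normSq (fieldSum j x) • (u x * (fderiv ℝ φ x (flowField j x) : ℂ)) =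
      ∑ m, u x * (fderiv ℝ (fun x => unitField j m x * φ x) x (coordDir j m) : ℂ) := by
    intro x
    rw [← Finset.mul_sum, ← ofReal_sum, sum_fderiv_unitField_mul hφ, real_smul]
    push_cast
    ring
  have h2 : ∀ x, normSq (fieldSum j x) • (flowDeriv j g x * (φ x : ℂ)) =
      ∑ m, g m x * ((unitField j m x * φ x : ℝ) : ℂ) := by
    intro x
    by_cases hx : x ∈ flowDomain j
    · rw [real_smul, ← mul_assoc, normSq_mul_flowDeriv g hx, Finset.sum_mul]
      refine Finset.sum_congr rfl fun m _ => ?_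
      push_cast
      ring
    · simp [image_eq_zero_of_notMem_tsupport fun h => hx (hφ.tsupport_subset h)]
  simp only [h1, h2]
  rw [integral_finsetSum _ fun m _ => hfd m, integral_finsetSum _ fun m _ => hgd m,
    ← Finset.sum_neg_distrib]
  exact Finset.sum_congr rfl fun m _ =>
    hw m _ (hψ m).contDiff (hψ m).hasCompactSupport (hψ m).tsupport_subset

theorem isWeakDerivOn_one (v : Config N) (Ω : Set (Config N)) :
    IsWeakDerivOn (fun _ => 1) (fun _ => 0) v Ω := by
  intro φ h1 h2 h3
  have hsub := IsTestOn.tsupport_fderiv_apply (φ := φ) (X := fun _ => v)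
  have hc := (h1.continuous_fderiv (by simp)).clm_apply (continuous_const (y := v))
  have h4 : Integrable fun x => fderiv ℝ φ x v :=
    hc.integrable_of_hasCompactSupport (h2.of_isClosed_subset (isClosed_tsupport _) hsub)
  have h5 : Integrable φ := h1.continuous.integrable_of_hasCompactSupport h2
  have h6 := integral_mul_fderiv_eq_neg_fderiv_mul_of_integrable (𝕜 := ℝ) (μ := volume)
    (f := fun _ : Config N => (1 : ℝ)) (g := φ) (v := v) (by simp) (by simpa using h4)
    (by simpa using h5) (fun x _ => differentiableAt_const _)
    fun x _ => h1.differentiable (by simp) x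
  simp only [one_mul, fderiv_fun_const, Pi.zero_apply, zero_apply, zero_mul,
    integral_zero, neg_zero] at h6
  simp only [one_mul, zero_mul, integral_zero, neg_zero]
  rw [integral_complex_ofReal, h6, ofReal_zero]

/-- This is `integral_flowDeriv` for the constant function 1, and it supplies the invariance of the
measure. -/
theorem integral_fderiv_flowField (hN : 2 ≤ N) {j : Fin N} {φ : Config N → ℝ}
    (hφ : IsTestOn φ (flowDomain j)) :
    ∫ x, fderiv ℝ φ x (flowField j x) ∂flowMeasure j = 0 := by
  have hone : IsLocallyL2On (fun _ : Config N => (1 : ℂ)) (flowDomain j) := fun K hK _ => by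
    have : IsFiniteMeasure (volume.restrict K) :=
      ⟨by rw [Measure.restrict_apply_univ]; exact hK.measure_lt_top⟩
    exact memLp_const 1
  have h := integral_flowDeriv hN (g := fun _ _ => 0) hone (fun m K _ _ => MemLp.zero')
    (fun m => isWeakDerivOn_one _ _) hφ
  simp only [one_mul, flowDeriv, mul_zero, Finset.sum_const_zero, zero_mul, integral_zero,
    neg_zero] at h
  rwa [integral_complex_ofReal, ofReal_eq_zero] at h

theorem isLocallyL2On_flowDeriv {j : Fin N} {g : Fin 2 → Config N → ℂ}
    (hg : ∀ m, IsLocallyL2On (g m) (flowDomain j)) :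
    IsLocallyL2On (flowDeriv j g) (flowDomain j) := by
  intro K hK hKE
  refine memLp_finsetSum _ fun m _ => ?_
  have hcont : ContinuousOn (fun x => ((unitField j m x / normSq (fieldSum j x) : ℝ) : ℂ)) K := by
    refine continuous_ofReal.comp_continuousOn (ContinuousOn.div (fun x hx => ?_)
      (continuous_normSq.comp_continuousOn ((continuousOn_fieldSum j).mono hKE))
      fun x hx => (normSq_pos.2 (fieldSum_ne_zero (hKE hx))).ne')
    exact (contDiffAt_unitField (hKE hx) m).continuousAt.continuousWithinAt
  obtain ⟨C, hC⟩ := hK.exists_bound_of_continuousOn hcont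
  have hKm := hK.isClosed.measurableSet
  have hgm := hg m K hK hKE
  refine hgm.of_le_mul (c := C) ((hcont.aestronglyMeasurable hKm).mul hgm.1) ?_
  filter_upwards [ae_restrict_mem hKm] with x hx
  rw [norm_mul]
  exact mul_le_mul_of_nonneg_right (hC x hx) (norm_nonneg _)

/-- The component of the magnetic gradient along the flow is bounded by the full magnetic
gradient. -/
theorem normSq_mul_le_magnetic {j : Fin N} (α : ℝ) (u : Config N → ℂ) (g : Fin 2 → Config N → ℂ)
    {x : Config N} (hx : x ∈ flowDomain j) :
    normSq (fieldSum j x) * ‖I * flowDeriv j g x + α * u x‖ ^ 2 ≤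
      ∑ m : Fin 2, ‖I * g m x + (potential α x j m : ℂ) * u x‖ ^ 2 := by
  have hρ := normSq_pos.2 (fieldSum_ne_zero hx)
  have hb : unitField j 0 x ^ 2 + unitField j 1 x ^ 2 = normSq (fieldSum j x) := by
    rw [unitField_zero, unitField_one, normSq_apply]
    ring
  simp only [potential_eq, Fin.sum_univ_two]
  set b₀ := unitField j 0 x
  set b₁ := unitField j 1 x
  set ρ := normSq (fieldSum j x) with hρdef
  set p := I * g 0 x + ((α * b₀ : ℝ) : ℂ) * u x with hp
  set q := I * g 1 x + ((α * b₁ : ℝ) : ℂ) * u x with hq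
  -- The left side is the scalar product of the magnetic gradient with the unit potential, whose
  -- squared length is ρ; Cauchy-Schwarz then loses exactly the factor ρ.
  have h1 : (ρ : ℂ) * (I * flowDeriv j g x + α * u x) = b₀ * p + b₁ * q := by
    have h2 := normSq_mul_flowDeriv g hx
    rw [Fin.sum_univ_two] at h2
    have h3 : (b₀ : ℂ) ^ 2 + (b₁ : ℂ) ^ 2 = (ρ : ℂ) := by exact_mod_cast hb
    rw [hp, hq]
    push_cast
    linear_combination I * h2 - α * u x * h3
  have h4 : ρ * ‖I * flowDeriv j g x + α * u x‖ ≤ |b₀| * ‖p‖ + |b₁| * ‖q‖ := by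
    calc ρ * ‖I * flowDeriv j g x + α * u x‖ = ‖(b₀ : ℂ) * p + b₁ * q‖ := by
          rw [← h1, norm_mul, norm_real, Real.norm_of_nonneg hρ.le]
      _ ≤ _ := by
          refine (norm_add_le _ _).trans ?_
          rw [norm_mul, norm_mul, norm_real, norm_real, Real.norm_eq_abs, Real.norm_eq_abs]
  have h5 : (|b₀| * ‖p‖ + |b₁| * ‖q‖) ^ 2 ≤ ρ * (‖p‖ ^ 2 + ‖q‖ ^ 2) := by
    rw [← hb, ← sq_abs b₀, ← sq_abs b₁]
    nlinarith [sq_nonneg (|b₀| * ‖q‖ - |b₁| * ‖p‖)]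
  have h6 := pow_le_pow_left₀ (by positivity) h4 2
  refine le_of_mul_le_mul_left ?_ hρ
  nlinarith [h6, h5]

/-- The Hardy inequality in the variable of one particle. -/
theorem hardy_particle (hN : 2 ≤ N) (j : Fin N) (α : ℝ) {u : Config N → ℂ}
    {g : Fin 2 → Config N → ℂ} (hum : Measurable u) (hgm : ∀ m, Measurable (g m))
    (hu : IsLocallyL2On u (flowDomain j)) (hg : ∀ m, IsLocallyL2On (g m) (flowDomain j))
    (hw : ∀ m, IsWeakDerivOn u (g m) (coordDir j m) (flowDomain j)) :
    ENNReal.ofReal (hardyConst N hN α) *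
        ∫⁻ x, ENNReal.ofReal (‖u x‖ ^ 2 * normSq (fieldSum j x)) ≤
      ∫⁻ x, ENNReal.ofReal (∑ m : Fin 2, ‖I * g m x + (potential α x j m : ℂ) * u x‖ ^ 2) := by
  obtain ⟨Φ, L, hL, hΦ, hper, hD⟩ := exists_configFlow hN j α
  have hwm : Measurable (flowDeriv j g) := by
    unfold flowDeriv
    refine Finset.measurable_sum _ fun m _ => Measurable.mul (measurable_ofReal.comp ?_) (hgm m)
    exact (measurable_unitField j m).div
      (continuous_normSq.measurable.comp (measurable_fieldSum j))
  have h := hΦ.hardy (isOpen_flowDomain hN j) (continuousOn_flowField hN j)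
    (flowMeasure_compl hN j) (flowMeasure_lt_top j)
    (fun φ hφ => integral_fderiv_flowField hN hφ) hum hwm (memLp_flowMeasure hu)
    (memLp_flowMeasure (isLocallyL2On_flowDeriv hg))
    (fun φ hφ => integral_flowDeriv hN hu hg hw hφ) hL hper hD
  have hlin : ∀ {F : Config N → ℝ}, ∫⁻ x, ENNReal.ofReal (F x) ∂flowMeasure j =
      ∫⁻ x in flowDomain j, ENNReal.ofReal (normSq (fieldSum j x) * F x) := by
    intro F
    rw [flowMeasure, lintegral_withDensity_eq_lintegral_mul_non_measurable _ (measurable_density j)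
      (Filter.Eventually.of_forall fun x => ENNReal.ofReal_lt_top)]
    simp only [Pi.mul_apply, ENNReal.ofReal_mul (normSq_nonneg _)]
  have hres : volume.restrict (flowDomain j) = volume :=
    Measure.restrict_eq_self_of_ae_mem (by rw [ae_iff]; exact volume_compl_flowDomain hN j)
  rw [hlin, hlin] at h
  refine (le_of_eq ?_).trans (h.trans ?_)
  · rw [hres]
    simp only [mul_comm]
  · refine (setLIntegral_mono' (isOpen_flowDomain hN j).measurableSet fun x hx => ?_).trans
      (setLIntegral_le_lintegral _ _)
    exact ENNReal.ofReal_le_ofReal (normSq_mul_le_magnetic α u g hx)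

theorem pairSum_le {x : Config N} (hx : x ∈ collisionFree N) :
    pairSum x ≤ ∑ j, normSq (fieldSum j x) := by
  have hinj : Function.Injective (toComplex N x) := fun k l hkl => hx (by
    rw [← dist_eq_zero, ← norm_toComplex_sub, hkl, sub_self, norm_zero])
  -- The diagonal terms may be included, since 0⁻¹ = 0.
  have herase : ∀ (j : Fin N), fieldSum j x = ∑ k, (toComplex N x j - toComplex N x k)⁻¹ :=
    fun j => Finset.sum_erase _ (by simp)
  simp only [herase]
  refine le_trans (le_of_eq ?_) (sum_normSq_inv_le hinj)
  refine Finset.sum_congr rfl fun j _ => ?_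
  rw [← Finset.sum_erase Finset.univ (a := j) (by simp)]
  refine Finset.sum_congr rfl fun k _ => ?_
  rw [map_inv₀, normSq_eq_norm_sq, norm_toComplex_sub, dist_comm, one_div]

/-! ### Measurable representatives and the sum over the particles. -/

theorem IsLocallyL2On.aestronglyMeasurable {f : Config N → ℂ} {Ω : Set (Config N)}
    (hf : IsLocallyL2On f Ω) (hΩ : IsOpen Ω) (hΩc : volume Ωᶜ = 0) :
    AEStronglyMeasurable f volume := by
  have hball : ∀ x ∈ Ω, ∃ r > 0, Metric.closedBall x r ⊆ Ω := fun x hx =>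
    Metric.nhds_basis_closedBall.mem_iff.1 (hΩ.mem_nhds hx)
  choose! r hr0 hrE using hball
  obtain ⟨t, htE, htc, hcov⟩ := TopologicalSpace.countable_cover_nhdsWithin
    (f := fun x => Metric.closedBall x (r x)) (s := Ω)
    fun x hx => mem_nhdsWithin_of_mem_nhds (Metric.closedBall_mem_nhds x (hr0 x hx))
  have : Countable t := htc.to_subtype
  have h1 : AEStronglyMeasurable f
      (volume.restrict (⋃ x : t, Metric.closedBall (x : Config N) (r x))) :=
    aestronglyMeasurable_iUnion_iff.2 fun x =>
      (hf _ (isCompact_closedBall _ _) (hrE _ (htE x.2))).1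
  rw [biUnion_eq_iUnion] at hcov
  rwa [Measure.restrict_eq_self_of_ae_mem] at h1
  rw [ae_iff]
  exact measure_mono_null (fun x hx hxE => hx (hcov hxE)) hΩc

theorem IsLocallyL2On.congr {f f' : Config N → ℂ} {Ω : Set (Config N)}
    (hf : IsLocallyL2On f Ω) (h : f =ᵐ[volume] f') : IsLocallyL2On f' Ω :=
  fun K hK hKΩ => (memLp_congr_ae (ae_restrict_of_ae h)).1 (hf K hK hKΩ)

theorem IsWeakDerivOn.congr {u u' g g' : Config N → ℂ} {v : Config N} {Ω : Set (Config N)}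
    (hw : IsWeakDerivOn u g v Ω) (hu : u =ᵐ[volume] u') (hg : g =ᵐ[volume] g') :
    IsWeakDerivOn u' g' v Ω := by
  intro φ h1 h2 h3
  have e1 : ∫ x, u' x * (fderiv ℝ φ x v : ℂ) = ∫ x, u x * (fderiv ℝ φ x v : ℂ) :=
    integral_congr_ae (by filter_upwards [hu] with x hx; rw [hx])
  have e2 : ∫ x, g' x * (φ x : ℂ) = ∫ x, g x * (φ x : ℂ) :=
    integral_congr_ae (by filter_upwards [hg] with x hx; rw [hx])
  rw [e1, e2]
  exact hw φ h1 h2 h3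

end ManyParticleHardy
end

theorem mainTheorem6 (N : ℕ) (hN : 2 ≤ N) (α : ℝ)
    (u : ManyParticleHardy.Config N → ℂ)
    (g : Fin N → Fin 2 → ManyParticleHardy.Config N → ℂ)
    (hu : ManyParticleHardy.IsH1LocOn u g (ManyParticleHardy.collisionFree N)) :
    ENNReal.ofReal (ManyParticleHardy.hardyConst N hN α) *
        ∫⁻ x, ENNReal.ofReal (‖u x‖ ^ 2 * ManyParticleHardy.pairSum x) ≤
      ∫⁻ x, ENNReal.ofReal (∑ j : Fin N, ManyParticleHardy.magneticDensity α u g j x) := by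
  open ManyParticleHardy in
  have hae : ∀ {f : Config N → ℂ}, IsLocallyL2On f (collisionFree N) →
      AEStronglyMeasurable f volume := fun hf =>
    (hf.mono (flowDomain_subset (⟨0, by omega⟩ : Fin N))).aestronglyMeasurable
      (isOpen_flowDomain hN _) (volume_compl_flowDomain hN _)
  have hum := hae hu.locallyL2
  have hgm := fun j m => hae (hu.locallyL2_grad j m)
  -- The argument along orbits composes with the flow and uses measurable functions, so `u` and its
  -- gradient are replaced by measurable representatives; hypotheses and integrals do not change.
  set v : Config N → ℂ := hum.mk u
  set w : Fin N → Fin 2 → Config N → ℂ := fun j m => (hgm j m).mk (g j m)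
  have huv : u =ᵐ[volume] v := hum.ae_eq_mk
  have hgw : ∀ j m, g j m =ᵐ[volume] w j m := fun j m => (hgm j m).ae_eq_mk
  have hvm : Measurable v := hum.stronglyMeasurable_mk.measurable
  have hwm : ∀ j m, Measurable (w j m) := fun j m => (hgm j m).stronglyMeasurable_mk.measurable
  have hone : ∀ j : Fin N, ENNReal.ofReal (hardyConst N hN α) *
      ∫⁻ x, ENNReal.ofReal (‖v x‖ ^ 2 * Complex.normSq (fieldSum j x)) ≤
        ∫⁻ x, ENNReal.ofReal (magneticDensity α v w j x) := fun j =>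
    hardy_particle hN j α hvm (hwm j)
      ((hu.locallyL2.congr huv).mono (flowDomain_subset j))
      (fun m => ((hu.locallyL2_grad j m).congr (hgw j m)).mono (flowDomain_subset j))
      (fun m => ((hu.weakDeriv j m).congr huv (hgw j m)).mono (flowDomain_subset j))
  have hmagnetic : ∀ j x, 0 ≤ magneticDensity α v w j x := fun j x =>
    Finset.sum_nonneg fun m _ => by positivity
  have hpot : ∀ (j : Fin N) (m : Fin 2), Measurable fun x : Config N => (potential α x j m : ℂ) := by
    intro j m
    simp only [potential_eq]
    exact Complex.measurable_ofReal.comp ((measurable_unitField j m).const_mul α)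
  have hdensm : ∀ j, Measurable fun x => ENNReal.ofReal (magneticDensity α v w j x) := fun j =>
    (Finset.measurable_sum _ fun m _ =>
      ((((hwm j m).const_mul _).add ((hpot j m).mul hvm)).norm.pow_const 2)).ennreal_ofReal
  have hstrm : ∀ j : Fin N, Measurable fun x =>
      ENNReal.ofReal (‖v x‖ ^ 2 * Complex.normSq (fieldSum j x)) := fun j =>
    ((hvm.norm.pow_const 2).mul
      (Complex.continuous_normSq.measurable.comp (measurable_fieldSum j))).ennreal_ofReal
  calc ENNReal.ofReal (hardyConst N hN α) * ∫⁻ x, ENNReal.ofReal (‖u x‖ ^ 2 * pairSum x)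
      ≤ ENNReal.ofReal (hardyConst N hN α) *
        ∫⁻ x, ∑ j : Fin N, ENNReal.ofReal (‖v x‖ ^ 2 * Complex.normSq (fieldSum j x)) := by
        refine mul_le_mul' le_rfl (lintegral_mono_ae ?_)
        have hmem : ∀ᵐ x : Config N, x ∈ flowDomain (⟨0, by omega⟩ : Fin N) := by
          rw [ae_iff]
          exact volume_compl_flowDomain hN _
        filter_upwards [huv, hmem] with x hx hxmem
        rw [← ENNReal.ofReal_sum_of_nonneg fun j _ =>
          mul_nonneg (by positivity) (Complex.normSq_nonneg _), ← Finset.mul_sum, hx]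
        exact ENNReal.ofReal_le_ofReal (mul_le_mul_of_nonneg_left
          (pairSum_le (flowDomain_subset _ hxmem)) (by positivity))
    _ = ∑ j : Fin N, ENNReal.ofReal (hardyConst N hN α) *
        ∫⁻ x, ENNReal.ofReal (‖v x‖ ^ 2 * Complex.normSq (fieldSum j x)) := by
        rw [lintegral_finsetSum _ fun j _ => hstrm j, Finset.mul_sum]
    _ ≤ ∑ j : Fin N, ∫⁻ x, ENNReal.ofReal (magneticDensity α v w j x) :=
        Finset.sum_le_sum fun j _ => hone j
    _ = ∫⁻ x, ENNReal.ofReal (∑ j : Fin N, magneticDensity α u g j x) := by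
        rw [← lintegral_finsetSum _ fun j _ => hdensm j]
        refine lintegral_congr_ae ?_
        have hall : ∀ᵐ x : Config N, ∀ j m, g j m x = w j m x :=
          ae_all_iff.2 fun j => ae_all_iff.2 fun m => hgw j m
        filter_upwards [huv, hall] with x hx hgx
        rw [← ENNReal.ofReal_sum_of_nonneg fun j _ => hmagnetic j x]
        congr 1
        refine Finset.sum_congr rfl fun j _ => Finset.sum_congr rfl fun m _ => ?_
        rw [hx, hgx]
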